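/- Let $(X,L)$ be a normal polarised complex projective variety of dimension $n\ge 1$, with $L$ an ample $\mathbb{Q}$-line bundle and $K_X$ a $\mathbb{Q}$-line bundle. Let $\rho=(\rho_0,\dots,\rho_n)\in\mathbb{C}^{n+1}$ with $\rho_n=i$, let $f(t)=\sum_{j=0}^n a_jt^j$ with $a_j\in\mathbb{C}$, $a_0=a_1=1$, and let $\Theta=1+\Theta_1+\Theta_2+\cdots$ with $\Theta_j\in H^{2j}(X,\mathbb{C})$ (for instance $\Theta_j\in H^{j,j}(X,\mathbb{C})$). The associated polynomial central charge is $$Z_k(X,L)=\sum_{l=0}^n\rho_lk^l\int_XL^l\cdot f(K_X)\cdot\Theta .$$ A test configuration for $(X,L)$ is a normal variety $\mathcal{X}$, with $K_{\mathcal{X}}$ a $\mathbb{Q}$-line bundle, with a $\mathbb{C}^*$-equivariant flat map to $\mathbb{C}$ and a $\mathbb{C}^*$-equivariant relatively ample $\mathbb{Q}$-line bundle $\mathcal{L}$, whose fibres over $t\neq 0$ are isomorphic to $(X,L)$; it is compactified equivariantly and trivially over $\infty$ to $(\mathcal{X},\mathcal{L})\to\mathbb{P}^1$. Put $$Z_k(\mathcal{X},\mathcal{L})=\sum_{l=0}^n\frac{\rho_lk^l}{l+1}\int_{\mathcal{X}}\mathcal{L}^{l+1}\cdot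 f(K_{\mathcal{X}/\mathbb{P}^1})\cdot\Theta ,$$ where intersection numbers on $\mathcal{X}$ are computed, by pulling back $\mathcal L$ and $K_{\mathcal{X}/\mathbb{P}^1}$ from $\mathcal{X}$ and $\Theta$ from $X$, on a smooth projective equivariant resolution of indeterminacy $\mathcal{Y}$ of the birational map $X\times\mathbb{P}^1\dashrightarrow\mathcal{X}$. $(X,L)$ is asymptotically $Z$-semistable if for each test configuration $\operatorname{Im}\big(Z_k(\mathcal{X},\mathcal{L})/Z_k(X,L)\big)\ge 0$ for all $k\gg0$. (i) Suppose that $Z$ is non-degenerate, i.e. $\operatorname{Re}(\rho_{n-1})<0$ and $\Theta_1=0$. If $(X,L)$ is asymptotically $Z$-semistable then it is K-semistable: for every test configuration $$\mathrm{DF}(\mathcal{X},\mathcal{L})=\frac{n\,\mu}{n+1}\int_{\mathcal X}\mathcal{L}^{n+1}+\int_{\mathcal X}\mathcal{L}^n\cdot K_{\mathcal{X}/\mathbb{P}^1}\ \ge 0,\qquad \mu=\frac{-K_X\cdot L^{n-1}}{L^n}.$$ (ii) Suppose that $Z$ is of map type, i.e. $\operatorname{Re}(\rho_{n-1})<0$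 and there are a morphism $p:X\to Y$ to a projective variety $Y$ and an ample ($\mathbb{Q}$-)line bundle $H$ on $Y$ such that $\Theta$ is the pullback under $p$ of a cohomology class on $Y$ and $\Theta_1=c_1(p^*H)$. If $(X,L)$ is asymptotically $Z$-semistable then the map $p$ is K-semistable: for every test configuration $$\mathrm{DF}_p(\mathcal{X},\mathcal{L})=\frac{n\,\mu_p}{n+1}\int_{\mathcal X}\mathcal{L}^{n+1}+\int_{\mathcal X}\mathcal{L}^n\cdot (K_{\mathcal{X}/\mathbb{P}^1}+p^*H)\ \ge 0,\qquad \mu_p=\frac{-(K_X+p^*H)\cdot L^{n-1}}{L^n}.$$ Moreover, for every test configuration, in case (i), and in case (ii) with $\mathrm{DF}_p$ in place of $\mathrm{DF}$, $$\operatorname{Im}\left(\frac{Z_k(\mathcal{X},\mathcal{L})}{Z_k(X,L)}\right)=\frac{-\operatorname{Re}(\rho_{n-1})}{n\,L^n}\,\mathrm{DF}(\mathcal{X},\mathcal{L})\,k^{-1}+O(k^{-2})\quad\text{as }k\to\infty .$$ -/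

import Mathlib

open CategoryTheory CategoryTheory.Limits AlgebraicGeometry TopologicalSpace Topology Filter

noncomputable section

namespace ZStability

/-! ### Alexander–Spanier cohomology with complex coefficients

On compact Hausdorff, locally contractible spaces (such as the spaces of complex points used
below) this is the usual cohomology `H^p(S, ℂ)`. -/

section Cohomology

/-- Alexander–Spanier `p`-cochains: arbitrary functions of `p + 1` points. -/
abbrev Cochain (S : Type) (p : ℕ) : Type := (Fin (p + 1) → S) → ℂ

/-- The coboundary `(δf)(x₀,…,x_{p+1}) = ∑ (-1)^i f(x₀,…,x̂ᵢ,…,x_{p+1})`. -/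
def coboundary (S : Type) (p : ℕ) : Cochain S p →ₗ[ℂ] Cochain S (p + 1) where
  toFun f v := ∑ i : Fin (p + 2), (-1 : ℂ) ^ (i : ℕ) * f (fun j => v (i.succAbove j))
  map_add' f g := by
    funext v
    simp only [Pi.add_apply, mul_add, Finset.sum_add_distrib]
  map_smul' c f := by
    funext v
    simp only [Pi.smul_apply, smul_eq_mul, RingHom.id_apply, Finset.mul_sum]
    exact Finset.sum_congr rfl fun i _ => by ring

/-- Pullback of cochains. -/
def Cochain.pull {S T : Type} (φ : S → T) (p : ℕ) : Cochain T p →ₗ[ℂ] Cochain S p where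
  toFun f v := f (φ ∘ v)
  map_add' _ _ := rfl
  map_smul' _ _ := rfl

theorem Cochain.pull_coboundary {S T : Type} (φ : S → T) (p : ℕ) (f : Cochain T p) :
    coboundary S p (Cochain.pull φ p f) = Cochain.pull φ (p + 1) (coboundary T p f) := rfl

variable (S : Type) [TopologicalSpace S]

/-- Cochains vanishing in a neighbourhood of the diagonal. -/
def locallyZero (p : ℕ) : Submodule ℂ (Cochain S p) where
  carrier := {f | ∀ x : S, ∃ U : Set S, IsOpen U ∧ x ∈ U ∧
    ∀ v : Fin (p + 1) → S, (∀ i, v i ∈ U) → f v = 0}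
  zero_mem' x := ⟨Set.univ, isOpen_univ, trivial, fun _ _ => rfl⟩
  add_mem' := by
    intro f g hf hg x
    obtain ⟨U, hU, hxU, h1⟩ := hf x
    obtain ⟨V, hV, hxV, h2⟩ := hg x
    refine ⟨U ∩ V, hU.inter hV, ⟨hxU, hxV⟩, fun v hv => ?_⟩
    simp [h1 v (fun i => (hv i).1), h2 v (fun i => (hv i).2)]
  smul_mem' := by
    intro c f hf x
    obtain ⟨U, hU, hxU, h1⟩ := hf x
    exact ⟨U, hU, hxU, fun v hv => by simp [h1 v hv]⟩

/-- Cocycles: cochains whose coboundary vanishes near the diagonal. -/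
def cocycles (p : ℕ) : Submodule ℂ (Cochain S p) :=
  (locallyZero S (p + 1)).comap (coboundary S p)

/-- Coboundaries, up to cochains vanishing near the diagonal. -/
def coboundaries : (p : ℕ) → Submodule ℂ (Cochain S p)
  | 0 => locallyZero S 0
  | p + 1 => LinearMap.range (coboundary S p) ⊔ locallyZero S (p + 1)

/-- `H^p(S, ℂ)`. -/
abbrev Coh (p : ℕ) : Type := cocycles S p ⧸ (coboundaries S p).submoduleOf (cocycles S p)

variable {S}

/-- The class of a cocycle. -/
def Coh.mk {p : ℕ} (z : cocycles S p) : Coh S p := Submodule.Quotient.mk z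

variable (S) in
/-- The unit class `1 ∈ H⁰(S, ℂ)`. -/
def Coh.one : Coh S 0 :=
  Coh.mk ⟨fun _ => 1, fun x => ⟨Set.univ, isOpen_univ, trivial, fun v _ => by
    simp [coboundary, Fin.sum_univ_two]⟩⟩

variable {T : Type} [TopologicalSpace T]

theorem Cochain.pull_locallyZero {φ : S → T} (hφ : Continuous φ) (p : ℕ) {f : Cochain T p}
    (hf : f ∈ locallyZero T p) : Cochain.pull φ p f ∈ locallyZero S p := by
  intro x
  obtain ⟨U, hU, hxU, h⟩ := hf (φ x)
  exact ⟨φ ⁻¹' U, hU.preimage hφ, hxU, fun v hv => h _ hv⟩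

/-- Pullback of cocycles along a continuous map. -/
def cocycles.pull (φ : C(S, T)) (p : ℕ) : cocycles T p →ₗ[ℂ] cocycles S p :=
  (Cochain.pull φ p).restrict fun f hf => by
    change coboundary S p (Cochain.pull φ p f) ∈ locallyZero S (p + 1)
    rw [Cochain.pull_coboundary]
    exact Cochain.pull_locallyZero φ.continuous _ hf

theorem coboundaries_le_comap (φ : C(S, T)) (p : ℕ) :
    coboundaries T p ≤ (coboundaries S p).comap (Cochain.pull φ p) := by
  cases p with
  | zero => exact fun f hf => Cochain.pull_locallyZero φ.continuous _ hf
  | succ p =>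
    refine sup_le ?_ fun f hf =>
      (le_sup_right : _ ≤ coboundaries S (p + 1)) (Cochain.pull_locallyZero φ.continuous _ hf)
    rintro _ ⟨g, rfl⟩
    exact (le_sup_left : _ ≤ coboundaries S (p + 1)) ⟨Cochain.pull φ p g, rfl⟩

/-- Pullback `φ^* : H^p(T, ℂ) → H^p(S, ℂ)`. -/
def Coh.pull (φ : C(S, T)) (p : ℕ) : Coh T p →ₗ[ℂ] Coh S p :=
  Submodule.mapQ _ _ (cocycles.pull φ p) fun _ hf => coboundaries_le_comap φ p hf

end Cohomology

/-! ### Complex varieties and their complex points -/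

section Varieties

/-- Schemes over `ℂ`. -/
abbrev CSch : Type 1 := Over (Spec (.of ℂ) : Scheme.{0})

/-- A complex variety: an integral separated scheme of finite type over `ℂ`. -/
class IsVariety (X : CSch) : Prop where
  integral : IsIntegral X.left
  separated : IsSeparated X.hom
  finiteType : LocallyOfFiniteType X.hom
  quasiCompact : QuasiCompact X.hom

attribute [instance] IsVariety.integral IsVariety.separated IsVariety.finiteType
  IsVariety.quasiCompact

/-- Normality: all local rings are integrally closed. -/
def IsNormal (X : CSch) : Prop :=
  ∀ x : X.left, IsIntegrallyClosed (X.left.presheaf.stalk x)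

/-- The product `X × Y` over `ℂ`. -/
def prod (X Y : CSch) : CSch := Over.mk (pullback.fst X.hom Y.hom ≫ X.hom)

def prod.fst (X Y : CSch) : prod X Y ⟶ X := Over.homMk (pullback.fst X.hom Y.hom) rfl

def prod.snd (X Y : CSch) : prod X Y ⟶ Y :=
  Over.homMk (pullback.snd X.hom Y.hom) pullback.condition.symm

def prod.lift {W X Y : CSch} (f : W ⟶ X) (g : W ⟶ Y) : W ⟶ prod X Y :=
  Over.homMk (pullback.lift f.left g.left (by rw [Over.w f, Over.w g])) (by
    change pullback.lift f.left g.left _ ≫ pullback.fst X.hom Y.hom ≫ X.hom = W.hom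
    rw [pullback.lift_fst_assoc, Over.w f])

/-- An open subscheme of a scheme over `ℂ`. -/
def openSub (X : CSch) (U : X.left.Opens) : CSch := Over.mk (U.ι ≫ X.hom)

def openSub.incl (X : CSch) (U : X.left.Opens) : openSub X U ⟶ X := Over.homMk U.ι rfl

/-- The complex points `X(ℂ)`. -/
abbrev ComplexPts (X : CSch) : Type := Over.mk (𝟙 (Spec (.of ℂ) : Scheme.{0})) ⟶ X

variable {X Y : CSch}

/-- The underlying point of the scheme. -/
def ComplexPts.pt (p : ComplexPts X) : X.left :=
  (Over.Hom.left p : Spec (.of ℂ) ⟶ X.left) (IsLocalRing.closedPoint ℂ)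

/-- The image of a complex point under a morphism. -/
def ComplexPts.map (f : X ⟶ Y) (p : ComplexPts X) : ComplexPts Y := CategoryStruct.comp p f

open Classical in
/-- The value `f(p) ∈ ℂ` of a regular function `f` on `U` at a complex point `p` of `U`
(and `0` if `p` does not lie in `U`). -/
def ComplexPts.eval (p : ComplexPts X) (U : X.left.Opens) (f : Γ(X.left, U)) : ℂ :=
  if h : p.pt ∈ U then
    (Scheme.stalkClosedPointTo (R := .of ℂ)
      (Over.Hom.left p : Spec (.of ℂ) ⟶ X.left)).hom (X.left.presheaf.germ U p.pt h f)
  else 0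

/-- The analytic topology on `X(ℂ)`: the coarsest one for which all `U(ℂ)` are open and all
regular functions on all `U(ℂ)` are continuous. -/
instance : TopologicalSpace (ComplexPts X) :=
  generateFrom {S | ∃ (U : X.left.Opens) (f : Γ(X.left, U)) (W : Set ℂ), IsOpen W ∧
    S = {p | p.pt ∈ U ∧ p.eval U f ∈ W}}

theorem ComplexPts.pt_map (f : X ⟶ Y) (p : ComplexPts X) : (p.map f).pt = f.left p.pt := rfl

theorem stalkClosedPointTo_germ_comp {X Y : Scheme.{0}} (g : Spec (.of ℂ) ⟶ X) (f : X ⟶ Y)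
    (U : Y.Opens) (s : Γ(Y, U)) (h : f (g (IsLocalRing.closedPoint ℂ)) ∈ U) :
    (Scheme.stalkClosedPointTo (R := .of ℂ) (g ≫ f)).hom
        (Y.presheaf.germ U (f (g (IsLocalRing.closedPoint ℂ))) h s) =
      (Scheme.stalkClosedPointTo (R := .of ℂ) g).hom
        (X.presheaf.germ (f ⁻¹ᵁ U) (g (IsLocalRing.closedPoint ℂ)) h (f.app U s)) := by
  have key := Scheme.stalkClosedPointTo_comp (R := .of ℂ) g f
  have e := Scheme.Hom.germ_stalkMap_apply f U (g (IsLocalRing.closedPoint ℂ)) h s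
  rw [← e]
  exact congr($(key).hom _)

theorem ComplexPts.eval_map (f : X ⟶ Y) (p : ComplexPts X) (U : Y.left.Opens)
    (s : Γ(Y.left, U)) : (p.map f).eval U s = p.eval (f.left ⁻¹ᵁ U) (f.left.app U s) := by
  by_cases h : f.left p.pt ∈ U
  · refine (dif_pos (h : (p.map f).pt ∈ U)).trans (Eq.trans ?_
      (dif_pos (h : p.pt ∈ f.left ⁻¹ᵁ U)).symm)
    exact stalkClosedPointTo_germ_comp (Over.Hom.left p) f.left U s h
  · refine (dif_neg (h : ¬ (p.map f).pt ∈ U)).trans (Eq.trans ?_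
      (dif_neg (h : ¬ p.pt ∈ f.left ⁻¹ᵁ U)).symm)
    rfl

theorem ComplexPts.continuous_map (f : X ⟶ Y) :
    Continuous (ComplexPts.map f : ComplexPts X → ComplexPts Y) := by
  refine continuous_generateFrom_iff.2 ?_
  rintro _ ⟨U, s, W, hW, rfl⟩
  refine isOpen_generateFrom_of_mem ⟨f.left ⁻¹ᵁ U, f.left.app U s, W, hW, ?_⟩
  ext p
  simp only [Set.mem_preimage, Set.mem_ofPred_eq, ComplexPts.eval_map]
  rfl

/-- The continuous map `X(ℂ) → Y(ℂ)` induced by a morphism. -/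
def ComplexPts.mapC (f : X ⟶ Y) : C(ComplexPts X, ComplexPts Y) :=
  ⟨ComplexPts.map f, ComplexPts.continuous_map f⟩

/-- The complex points of the closed subvariety with generic point `x`. -/
def subvarietyPts (x : X.left) : Set (ComplexPts X) := {p | x ⤳ p.pt}

/-- Restriction of cohomology classes to the closed subvariety with generic point `x`. -/
def restrict (x : X.left) (p : ℕ) : Coh (ComplexPts X) p →ₗ[ℂ] Coh (subvarietyPts x) p :=
  Coh.pull ⟨Subtype.val, continuous_subtype_val⟩ p

/-- The multiplicative group over `ℂ`. -/
def Gm : CSch := Over.mk (Spec.map (CommRingCat.ofHom (algebraMap ℂ (LaurentPolynomial ℂ))))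

/-- The complex point of the multiplicative group given by `c ∈ ℂˣ`. -/
def Gm.pt (c : ℂˣ) : ComplexPts Gm :=
  Over.homMk (Spec.map (CommRingCat.ofHom (LaurentPolynomial.eval₂ (RingHom.id ℂ) c))) (by
    have e : (LaurentPolynomial.eval₂ (RingHom.id ℂ) c).comp
        (algebraMap ℂ (LaurentPolynomial ℂ)) = RingHom.id ℂ := by
      ext z
      exact LaurentPolynomial.eval₂_C _ _ z
    change Spec.map _ ≫ Spec.map _ = 𝟙 _
    rw [← Spec.map_comp, ← CommRingCat.ofHom_comp, e]
    exact Spec.map_id _)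

/-- The point `σ(c, p)`, for a morphism `σ : 𝔾ₘ × X → X`. -/
def actPt (σ : prod Gm X ⟶ X) (c : ℂˣ) (p : ComplexPts X) : ComplexPts X :=
  ComplexPts.map σ (prod.lift (Gm.pt c) p)

/-- A morphism `𝔾ₘ × X → X` is a `ℂ^*`-action. For the varieties to which this is applied, it is
enough to require the axioms of an action on complex points. -/
structure IsAction (σ : prod Gm X ⟶ X) : Prop where
  one : ∀ p, actPt σ 1 p = p
  mul : ∀ c d p, actPt σ (c * d) p = actPt σ c (actPt σ d p)

/-! ### The projective line -/

instance : GradedAlgebra (MvPolynomial.homogeneousSubmodule (Fin 2) ℂ) :=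
  MvPolynomial.gradedAlgebra

/-- The grading of `ℂ[x₀, x₁]`. -/
abbrev gr : ℕ → Submodule ℂ (MvPolynomial (Fin 2) ℂ) :=
  MvPolynomial.homogeneousSubmodule (Fin 2) ℂ

/-- `ℙ¹ = Proj ℂ[x₀, x₁]`. -/
def P1 : CSch :=
  Over.mk (Proj.toSpecZero gr ≫ Spec.map (CommRingCat.ofHom (algebraMap ℂ (gr 0))))

/-- The chart `x_i ≠ 0`; `chart 1` is the complement of `∞ = [1 : 0]` and
`chart 0` is the complement of `0 = [0 : 1]`. -/
def P1.chart (i : Fin 2) : P1.left.Opens := Proj.basicOpen gr (MvPolynomial.X i)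

/-- The coordinate `x_j / x_i` on the chart `x_i ≠ 0`. -/
def P1.coord (i j : Fin 2) : Γ(P1.left, P1.chart i) :=
  Proj.awayToSection gr (MvPolynomial.X i)
    (HomogeneousLocalization.Away.mk gr (d := 1) (MvPolynomial.isHomogeneous_X ℂ i) 1
      (MvPolynomial.X j) (by simpa using MvPolynomial.isHomogeneous_X ℂ j))

/-- `q = c • p` for the standard action `c • [x₀ : x₁] = [c x₀ : x₁]` on `ℙ¹`. -/
def IsScaled (c : ℂˣ) (p q : ComplexPts P1) : Prop :=
  (p.pt ∈ P1.chart 1 → q.pt ∈ P1.chart 1 ∧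
    q.eval (P1.chart 1) (P1.coord 1 0) = c * p.eval (P1.chart 1) (P1.coord 1 0)) ∧
  (p.pt ∈ P1.chart 0 → q.pt ∈ P1.chart 0 ∧
    q.eval (P1.chart 0) (P1.coord 0 1) = (c : ℂ)⁻¹ * p.eval (P1.chart 0) (P1.coord 0 1))

end Varieties

/-! ### Line bundles, given by transition functions -/

section LineBundles

/-- The germ at `x ∈ U ∩ V` of a function on `U ∩ V`. -/
def germ₂ {X : Scheme.{0}} {U V : X.Opens} (f : Γ(X, U ⊓ V)) (x : X) (hU : x ∈ U) (hV : x ∈ V) :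
    X.presheaf.stalk x :=
  X.presheaf.germ (U ⊓ V) x ⟨hU, hV⟩ f

section germ

variable {X Y : Scheme.{0}} {U V U' V' : X.Opens} {x : X} (hU : x ∈ U) (hV : x ∈ V)

theorem germ₂_mul (f f' : Γ(X, U ⊓ V)) :
    germ₂ (f * f') x hU hV = germ₂ f x hU hV * germ₂ f' x hU hV := map_mul _ _ _

theorem germ₂_pow (f : Γ(X, U ⊓ V)) (m : ℕ) :
    germ₂ (f ^ m) x hU hV = germ₂ f x hU hV ^ m := map_pow _ _ _

theorem germ₂_res (hU' : x ∈ U') (hV' : x ∈ V') (h : U ⊓ V ≤ U' ⊓ V') (f : Γ(X, U' ⊓ V')) :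
    germ₂ (X.presheaf.map (homOfLE h).op f) x hU hV = germ₂ f x hU' hV' :=
  X.presheaf.germ_res_apply (homOfLE h) x ⟨hU, hV⟩ f

theorem germ₂_app (φ : Y ⟶ X) (y : Y) (hU : φ y ∈ U) (hV : φ y ∈ V) (f : Γ(X, U ⊓ V)) :
    germ₂ (U := φ ⁻¹ᵁ U) (V := φ ⁻¹ᵁ V) (φ.app (U ⊓ V) f) y hU hV =
      (φ.stalkMap y).hom (germ₂ f (φ y) hU hV) :=
  (Scheme.Hom.germ_stalkMap_apply φ (U ⊓ V) y ⟨hU, hV⟩ f).symm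

end germ

/-- A line bundle on a scheme, given by a trivialising open cover and transition functions:
a section is a family `sᵢ` of functions on the `Uᵢ` with `sᵢ = gᵢⱼ sⱼ`. -/
structure LineBundle (X : Scheme.{0}) where
  ι : Type
  U : ι → X.Opens
  cover : ∀ x : X, ∃ i, x ∈ U i
  g : ∀ i j, Γ(X, U i ⊓ U j)
  g_self : ∀ i x (hi : x ∈ U i), germ₂ (g i i) x hi hi = 1
  cocycle : ∀ i j k x (hi : x ∈ U i) (hj : x ∈ U j) (hk : x ∈ U k),
    germ₂ (g i j) x hi hj * germ₂ (g j k) x hj hk = germ₂ (g i k) x hi hk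

namespace LineBundle

variable {X Y : Scheme.{0}}

/-- The tensor power `M^m`. -/
def pow (M : LineBundle X) (m : ℕ) : LineBundle X where
  ι := M.ι
  U := M.U
  cover := M.cover
  g i j := M.g i j ^ m
  g_self i x hi := by rw [germ₂_pow, M.g_self, one_pow]
  cocycle i j k x hi hj hk := by
    rw [germ₂_pow, germ₂_pow, germ₂_pow, ← mul_pow, M.cocycle i j k x hi hj hk]

/-- The dual line bundle `M⁻¹`. -/
def dual (M : LineBundle X) : LineBundle X where
  ι := M.ι
  U := M.U
  cover := M.cover
  g i j := X.presheaf.map (homOfLE (inf_comm (M.U i) (M.U j)).le).op (M.g j i)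
  g_self i x hi := by
    rw [germ₂_res hi hi hi hi, M.g_self]
  cocycle i j k x hi hj hk := by
    rw [germ₂_res hi hj hj hi, germ₂_res hj hk hk hj, germ₂_res hi hk hk hi, mul_comm,
      M.cocycle k j i x hk hj hi]

/-- The tensor product of line bundles. -/
def tensor (M N : LineBundle X) : LineBundle X where
  ι := M.ι × N.ι
  U a := M.U a.1 ⊓ N.U a.2
  cover x := by
    obtain ⟨i, hi⟩ := M.cover x
    obtain ⟨j, hj⟩ := N.cover x
    exact ⟨(i, j), hi, hj⟩
  g a b := X.presheaf.map (homOfLE (inf_le_inf inf_le_left inf_le_left)).op (M.g a.1 b.1) *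
    X.presheaf.map (homOfLE (inf_le_inf inf_le_right inf_le_right)).op (N.g a.2 b.2)
  g_self a x ha := by
    rw [germ₂_mul, germ₂_res ha ha ha.1 ha.1, germ₂_res ha ha ha.2 ha.2,
      M.g_self _ _ ha.1, N.g_self _ _ ha.2, one_mul]
  cocycle a b c x ha hb hc := by
    rw [germ₂_mul, germ₂_mul, germ₂_mul, germ₂_res ha hb ha.1 hb.1, germ₂_res ha hb ha.2 hb.2,
      germ₂_res hb hc hb.1 hc.1, germ₂_res hb hc hb.2 hc.2, germ₂_res ha hc ha.1 hc.1,
      germ₂_res ha hc ha.2 hc.2, mul_mul_mul_comm, M.cocycle _ _ _ x ha.1 hb.1 hc.1,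
      N.cocycle _ _ _ x ha.2 hb.2 hc.2]

/-- The pullback `f^* M`. -/
def pullback (f : Y ⟶ X) (M : LineBundle X) : LineBundle Y where
  ι := M.ι
  U i := f ⁻¹ᵁ M.U i
  cover y := M.cover (f y)
  g i j := f.app (M.U i ⊓ M.U j) (M.g i j)
  g_self i y hi := by
    rw [germ₂_app f y hi hi, M.g_self i (f y) hi, map_one]
  cocycle i j k y hi hj hk := by
    rw [germ₂_app f y hi hj, germ₂_app f y hj hk, germ₂_app f y hi hk, ← map_mul,
      M.cocycle i j k (f y) hi hj hk]

/-- An isomorphism of line bundles `M ≅ N`, in coordinates `tₐ = φᵢₐ sᵢ`. -/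
structure Iso (M N : LineBundle X) where
  φ : ∀ i a, Γ(X, M.U i ⊓ N.U a)
  unit : ∀ i a x (hi : x ∈ M.U i) (ha : x ∈ N.U a),
    IsUnit (germ₂ (φ i a) x hi ha)
  compat : ∀ i j a b x (hi : x ∈ M.U i) (hj : x ∈ M.U j) (ha : x ∈ N.U a) (hb : x ∈ N.U b),
    germ₂ (φ j b) x hj hb =
      germ₂ (N.g b a) x hb ha * germ₂ (φ i a) x hi ha * germ₂ (M.g i j) x hi hj

/-- A regular section of `M` over an open set `W`. -/
structure Section (M : LineBundle X) (W : X.Opens) where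
  s : ∀ i, Γ(X, M.U i ⊓ W)
  compat : ∀ i j x (hi : x ∈ M.U i) (hj : x ∈ M.U j) (hW : x ∈ W),
    germ₂ (s i) x hi hW = germ₂ (M.g i j) x hi hj * germ₂ (s j) x hj hW

/-- `M` is ample over the open set `W`: every point of `W` has an affine neighbourhood
of the form `{s ≠ 0}`, for a section `s` over `W` of a positive power of `M`. -/
def IsAmpleOver (M : LineBundle X) (W : X.Opens) : Prop :=
  ∀ x ∈ W, ∃ (m : ℕ) (s : (M.pow m).Section W) (A : X.Opens), 0 < m ∧ IsAffineOpen A ∧ x ∈ A ∧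
    A ≤ W ∧ ∀ i y (hi : y ∈ M.U i) (hW : y ∈ W),
      y ∈ A ↔ IsUnit (germ₂ (s.s i) y hi hW)

/-- Ampleness (on a quasi-compact scheme). -/
def IsAmple (M : LineBundle X) : Prop := M.IsAmpleOver ⊤

end LineBundle

/-- A linearisation of a line bundle with respect to a `ℂ^*`-action `σ` on `X`: a lift
of the action to the line bundle, given on fibres by `Lₓ → L_{c•x}`,
`(c • s)ⱼ = Φᵢⱼ(c, x) sᵢ`. -/
structure Linearisation {X : CSch} (σ : prod Gm X ⟶ X) (M : LineBundle X.left) where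
  Φ : (M.pullback (prod.snd Gm X).left).Iso (M.pullback σ.left)
  one : ∀ (p : ComplexPts X) i, p.pt ∈ M.U i →
    ComplexPts.eval (X := prod Gm X) (prod.lift (Gm.pt 1) p) _ (Φ.φ i i) = 1
  mul : ∀ (c d : ℂˣ) (p : ComplexPts X) i j k, p.pt ∈ M.U i → (actPt σ d p).pt ∈ M.U j →
    (actPt σ (c * d) p).pt ∈ M.U k →
    ComplexPts.eval (X := prod Gm X) (prod.lift (Gm.pt (c * d)) p) _ (Φ.φ i k) =
      ComplexPts.eval (X := prod Gm X) (prod.lift (Gm.pt c) (actPt σ d p)) _ (Φ.φ j k) *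
      ComplexPts.eval (X := prod Gm X) (prod.lift (Gm.pt d) p) _ (Φ.φ i j)

/-- A `ℚ`-line bundle `(1/m) M`. -/
structure QLineBundle (X : Scheme.{0}) where
  M : LineBundle X
  m : ℕ
  pos : 0 < m

namespace QLineBundle

variable {X Y : Scheme.{0}}

def pullback (f : Y ⟶ X) (L : QLineBundle X) : QLineBundle Y := ⟨L.M.pullback f, L.m, L.pos⟩

/-- The difference `K - L`. -/
def sub (K L : QLineBundle X) : QLineBundle X :=
  ⟨(K.M.pow L.m).tensor (L.M.pow K.m).dual, K.m * L.m, Nat.mul_pos K.pos L.pos⟩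

/-- Isomorphism of `ℚ`-line bundles. -/
def IsIso (K L : QLineBundle X) : Prop :=
  ∃ N : ℕ, 0 < N ∧ Nonempty ((K.M.pow (N * L.m)).Iso (L.M.pow (N * K.m)))

def IsAmple (L : QLineBundle X) : Prop := L.M.IsAmple

/-- Relative ampleness with respect to a morphism `f`. -/
def IsRelativelyAmple (L : QLineBundle X) (f : X ⟶ Y) : Prop :=
  ∀ V : Y.Opens, IsAffineOpen V → L.M.IsAmpleOver (f ⁻¹ᵁ V)

end QLineBundle

end LineBundles

/-! ### Divisors of rational sections, intersection numbers

A closed subvariety `V` of a scheme `X` of finite type over `ℂ` is represented by its generic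
point `x`; its function field is the residue field of `X` at `x`. -/

section Intersection

variable {X : Scheme.{0}}

/-- The local ring at `y` of the closed subvariety `V` with generic point `x`, as a subring of the
function field of `V`. -/
def localRing {x y : X} (h : x ⤳ y) : Subring (X.residueField x) :=
  (X.presheaf.stalkSpecializes h ≫ X.residue x).hom.range

open Classical in
/-- The order of vanishing of a nonzero `f` in the fraction field of a one-dimensional
local domain `R`: `length(R/a) - length(R/b)` if `f = a/b`. -/
def ordAt {F : Type} [Field F] (R : Subring F) (f : F) : ℤ :=
  if h : ∃ ab : R × R, ab.1 ≠ 0 ∧ ab.2 ≠ 0 ∧ f * ab.2 = ab.1 then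
    (Ring.ord R h.choose.1).toNat - (Ring.ord R h.choose.2).toNat
  else 0

/-- `y` is the generic point of a subvariety of codimension one of the subvariety with generic
point `x`. -/
def IsCodimOne (x y : X) : Prop :=
  x ⤳ y ∧ x ≠ y ∧ ∀ z, x ⤳ z → z ⤳ y → z = x ∨ z = y

/-- A nonzero rational section of the restriction of `M` to the subvariety with
generic point `x`. -/
structure RatSection (M : LineBundle X) (x : X) where
  s : ∀ i, x ∈ M.U i → X.residueField x
  ne_zero : ∀ i hi, s i hi ≠ 0
  compat : ∀ i j hi hj, s i hi = X.evaluation (M.U i ⊓ M.U j) x ⟨hi, hj⟩ (M.g i j) * s j hj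

/-- The order of a rational section at a point `y` of the subvariety. -/
def RatSection.ord {M : LineBundle X} {x y : X} (s : RatSection M x) (h : x ⤳ y) : ℤ :=
  ordAt (localRing h) (s.s (M.cover y).choose (h.mem_open (M.U _).isOpen (M.cover y).choose_spec))

/-- The section has no poles. -/
def RatSection.IsRegular {M : LineBundle X} {x : X} (s : RatSection M x) : Prop :=
  ∀ y (h : x ⤳ y) i (hi : y ∈ M.U i), s.s i (h.mem_open (M.U i).isOpen hi) ∈ localRing h

open Classical in
/-- The multiplicity at `y` of a `ℚ`-divisor on the subvariety `V` with generic point `x` which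
represents the line bundle `M|_V`: the divisor of a rational section of `M|_V`. We use an effective
divisor, namely `div(s)/m` for a regular section `s` of some `M^m|_V`, if there is one. -/
def divisor (M : LineBundle X) (x y : X) : ℚ :=
  if hxy : x ⤳ y then
    if h : ∃ a : (Σ m : ℕ, RatSection (M.pow m) x), 0 < a.1 ∧ a.2.IsRegular then
      (h.choose.2.ord hxy : ℚ) / h.choose.1
    else if h : Nonempty (RatSection M x) then h.some.ord hxy else 0
  else 0

/-- The first argument is a list `L₁, …, L_r` of `ℚ`-line bundles. Intersecting the subvariety `V`
with generic point `x` successively with divisors which represent `L₁, …, L_r` gives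
a cycle of dimension `dim V - r`, and `cycleSum` is the sum of the values at the components of this
cycle of the function `b`, with multiplicities. -/
def cycleSum {A : Type} [AddCommGroup A] [Module ℚ A] :
    List (QLineBundle X) → (X → A) → X → A
  | [], b, x => b x
  | L :: Ls, b, x =>
    ∑ᶠ y : {y : X // IsCodimOne x y}, (divisor L.M x y / L.m) • cycleSum Ls b y

/-- The intersection number `L₁ · … · L_d` on the subvariety (complete, of dimension `d`) with
generic point `x`. -/
def intersection (Ls : List (QLineBundle X)) (x : X) : ℚ := cycleSum Ls (fun _ => 1) x

end Intersection

/-! ### Chern classes, and integration of cohomology classes -/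

section Chern

variable {X : CSch}

/-- `c` is a cocycle representing the first Chern class of `M` in `H²(X(ℂ), ℂ)`. Here
`t x y : L_x → L_y`, given in coordinates by `s_j(y) = t i j x y * s_i(x)`, is
an identification of nearby fibres of `L` which is continuous near the diagonal and
the identity on it, and `c(x,y,z)` is `1/2π` times the argument of the
holonomy `L_x → L_y → L_z → L_x`. -/
def IsChernCocycle (M : LineBundle X.left) (c : cocycles (ComplexPts X) 2) : Prop :=
  ∃ t : M.ι → M.ι → ComplexPts X → ComplexPts X → ℂ,
    (∀ i i' j j' x y, x.pt ∈ M.U i → x.pt ∈ M.U i' → y.pt ∈ M.U j → y.pt ∈ M.U j' →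
      t i' j' x y = y.eval _ (M.g j' j) * t i j x y * x.eval _ (M.g i i')) ∧
    (∀ i x, x.pt ∈ M.U i → t i i x x = 1) ∧
    (∀ i x, x.pt ∈ M.U i → ∃ N : Set (ComplexPts X), IsOpen N ∧ x ∈ N ∧
      (∀ y ∈ N, y.pt ∈ M.U i) ∧
      ContinuousOn (fun q : ComplexPts X × ComplexPts X => t i i q.1 q.2) (N ×ˢ N)) ∧
    ∀ (v : Fin 3 → ComplexPts X) i j k, (v 0).pt ∈ M.U i → (v 1).pt ∈ M.U j →
      (v 2).pt ∈ M.U k →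
      c.1 v = ((t i j (v 0) (v 1) * t j k (v 1) (v 2) / t i k (v 0) (v 2)).arg /
        (2 * Real.pi) : ℝ)

open Classical in
/-- The first Chern class `c₁(M) ∈ H²(X(ℂ), ℂ)`. -/
def chernClass (M : LineBundle X.left) : Coh (ComplexPts X) 2 :=
  if h : ∃ c, IsChernCocycle M c then Coh.mk h.choose else 0

/-- The first Chern class of a `ℚ`-line bundle. -/
def qChernClass (L : QLineBundle X.left) : Coh (ComplexPts X) 2 :=
  (L.m : ℂ)⁻¹ • chernClass L.M

/-- `I` is integration of classes of degree `2d` over the closed subvariety `V`, of dimension `d`,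
with generic point `x`: the linear form on the one-dimensional space `H^{2d}(V(ℂ), ℂ)` with
`I(c₁(M₁) ∪ … ∪ c₁(M_d)) = M₁ · … · M_d` for all line bundles `Mᵢ`. -/
def IsIntegration (x : X.left) (d : ℕ) (I : Coh (subvarietyPts x) (2 * d) →ₗ[ℂ] ℂ) : Prop :=
  ∀ (M : Fin d → LineBundle X.left) (c : Fin d → cocycles (ComplexPts X) 2)
    (z : cocycles (ComplexPts X) (2 * d)),
    (∀ i, IsChernCocycle (M i) (c i)) →
    (∀ v : Fin (2 * d + 1) → ComplexPts X, z.1 v = ∏ i : Fin d,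
      (c i).1 ![v ⟨2 * i, by omega⟩, v ⟨2 * i + 1, by omega⟩, v ⟨2 * i + 2, by omega⟩]) →
    I (restrict x (2 * d) (Coh.mk z)) =
      intersection (List.ofFn fun i => ⟨M i, 1, one_pos⟩) x

open Classical in
/-- `∫_V θ`, for the closed subvariety `V` of dimension `d` with generic point `x`. -/
def integral (x : X.left) (d : ℕ) : Coh (subvarietyPts x) (2 * d) →ₗ[ℂ] ℂ :=
  if h : ∃ I, IsIntegration x d I then h.choose else 0

/-- The intersection number `∫_X L₁ · … · L_r · θ`, for a class `θ` of degree `2d`,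
`r + d = dim X`: the integral of `θ` over the cycle `L₁ · … · L_r`. -/
def pairing (X : CSch) [IsVariety X] (Ls : List (QLineBundle X.left)) {d : ℕ}
    (θ : Coh (ComplexPts X) (2 * d)) : ℂ :=
  cycleSum Ls (fun y => integral y d (restrict y (2 * d) θ)) (genericPoint X.left)

/-- The intersection number `L₁ · … · L_n` on an `n`-dimensional complete variety `X`. -/
def number (X : CSch) [IsVariety X] (Ls : List (QLineBundle X.left)) : ℝ :=
  (intersection Ls (genericPoint X.left) : ℚ)

end Chern

/-! ### The canonical class -/

section Canonical

variable (X : CSch)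

/-- The structure of `ℂ`-algebra on the local ring at `x`. -/
def stalkHom (x : X.left) : ℂ →+* X.left.presheaf.stalk x :=
  (Spec.preimage (X.left.fromSpecStalk x ≫ X.hom)).hom

/-- For a local `ℂ`-algebra `A`: `da₁, …, daₙ` is a basis of the module of differentials. -/
def IsDifferentialBasis {A : Type} [CommRing A] (φ : ℂ →+* A) {n : ℕ} (a : Fin n → A) : Prop :=
  letI := φ.toAlgebra
  LinearIndependent A (fun i => KaehlerDifferential.D ℂ A (a i)) ∧
    Submodule.span A (Set.range fun i => KaehlerDifferential.D ℂ A (a i)) = ⊤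

/-- `dtᵢ = ∑ⱼ Jᵢⱼ daⱼ`. -/
def IsJacobian {A : Type} [CommRing A] (φ : ℂ →+* A) {n : ℕ} (t a : Fin n → A)
    (J : Matrix (Fin n) (Fin n) A) : Prop :=
  letI := φ.toAlgebra
  ∀ i, KaehlerDifferential.D ℂ A (t i) = ∑ j, J i j • KaehlerDifferential.D ℂ A (a j)

/-- The `ℚ`-line bundle `K` is the canonical class of the `n`-dimensional normal variety `X`:
there is a rational `n`-form `η = dt₁ ∧ … ∧ dtₙ ≠ 0` such that `K.m • div(η)` is the divisor of
a rational section of `K.M`. Here the order of `η` at a point `y` of codimension one is the order of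
the function `f` with `η = f da₁ ∧ … ∧ daₙ`, where `da₁, …, daₙ` is a basis of the differentials of
the local ring at `y`. -/
def IsCanonical (n : ℕ) (K : QLineBundle X.left) : Prop :=
  ∃ ξ : X.left, IsGenericPoint ξ ⊤ ∧
  ∃ t : Fin n → X.left.residueField ξ,
    IsDifferentialBasis ((X.left.residue ξ).hom.comp (stalkHom X ξ)) t ∧
  ∃ s : RatSection K.M ξ, ∀ (y : X.left) (h : ξ ⤳ y), IsCodimOne ξ y →
    ∀ (a : Fin n → X.left.presheaf.stalk y) (J : Matrix (Fin n) (Fin n) (X.left.residueField ξ)),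
      IsDifferentialBasis (stalkHom X y) a →
      IsJacobian ((X.left.residue ξ).hom.comp (stalkHom X ξ)) t
        (fun i => (X.left.presheaf.stalkSpecializes h ≫ X.left.residue ξ).hom (a i)) J →
      s.ord h = K.m * ordAt (localRing h) J.det

end Canonical

/-! ### Polarised varieties, test configurations -/

section TestConfigurations

/-- A normal polarised variety `(X, L)` of dimension `n`, projective over `ℂ`, with `L` an ample
`ℚ`-line bundle, for which `K_X` is a `ℚ`-line bundle. -/
structure PolarisedVariety (n : ℕ) where
  X : CSch
  [isVariety : IsVariety X]
  proper : IsProper X.hom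
  normal : IsNormal X
  dim : topologicalKrullDim X.left = n
  L : QLineBundle X.left
  ample : L.IsAmple
  K : QLineBundle X.left
  isCanonical : IsCanonical X n K

attribute [instance] PolarisedVariety.isVariety

variable {n : ℕ}

/-- `X × ℙ¹`. -/
abbrev PolarisedVariety.XP (P : PolarisedVariety n) : CSch := prod P.X P1

/-- The open subset `X × (ℙ¹ ∖ {0})` of `X × ℙ¹`. -/
abbrev PolarisedVariety.V (P : PolarisedVariety n) : P.XP.left.Opens :=
  (prod.snd P.X P1).left ⁻¹ᵁ P1.chart 0

/-- A test configuration for `(X, L)`, in its compactified form over `ℙ¹`. The total space is trivial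
over `ℙ¹ ∖ {0}`, compatibly with the `ℂ^*`-actions, where `ℂ^*` acts trivially on the factor `X` of
`X × (ℙ¹ ∖ {0})`; in particular all fibres over `t ≠ 0` are isomorphic to `(X, L)`. Over
`ℙ¹ ∖ {∞} = ℂ` this is a test configuration in the usual sense, of which `tot` is the canonical
compactification (`L` is determined up to twisting by pullbacks from `ℙ¹`, which corresponds to
changing the linearisation by a character). -/
structure TestConfiguration (P : PolarisedVariety n) where
  tot : CSch
  [isVariety : IsVariety tot]
  proper : IsProper tot.hom
  normal : IsNormal tot
  K : QLineBundle tot.left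
  isCanonical : IsCanonical tot (n + 1) K
  π : tot ⟶ P1
  flat : Flat π.left
  L : QLineBundle tot.left
  relativelyAmple : L.IsRelativelyAmple π.left
  σ : prod Gm tot ⟶ tot
  isAction : IsAction σ
  /-- The action lifts to (a power of) the `ℚ`-line bundle. -/
  linearised : ∃ N : ℕ, 0 < N ∧ Nonempty (Linearisation σ (L.M.pow N))
  equivariant : ∀ c p, IsScaled c (p.map π) ((actPt σ c p).map π)
  triv : openSub P.XP P.V ⟶ tot
  triv_open : IsOpenImmersion triv.left
  triv_range : Set.range triv.left = (π.left ⁻¹ᵁ P1.chart 0 : Set tot.left)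
  triv_π : triv ≫ π = openSub.incl _ _ ≫ prod.snd P.X P1
  triv_equivariant : ∀ (c : ℂˣ) (p q : ComplexPts (openSub P.XP P.V)),
    p.map (openSub.incl _ _ ≫ prod.fst P.X P1) = q.map (openSub.incl _ _ ≫ prod.fst P.X P1) →
    IsScaled c (p.map (openSub.incl _ _ ≫ prod.snd P.X P1))
      (q.map (openSub.incl _ _ ≫ prod.snd P.X P1)) →
    q.map triv = actPt σ c (p.map triv)
  triv_L : (L.pullback triv.left).IsIso (P.L.pullback (openSub.incl _ _ ≫ prod.fst P.X P1).left)
  /-- The canonical class of `ℙ¹`. -/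
  KP1 : QLineBundle P1.left
  isCanonicalP1 : IsCanonical P1 1 KP1

attribute [instance] TestConfiguration.isVariety

/-- The relative canonical class `K_𝒳 - π^* K_{ℙ¹}`. -/
def TestConfiguration.relK {P : PolarisedVariety n} (T : TestConfiguration P) :
    QLineBundle T.tot.left :=
  T.K.sub (T.KP1.pullback T.π.left)

/-- An equivariant resolution of indeterminacy of the birational map `X × ℙ¹ ⇢ 𝒳` by a smooth
projective variety `𝒴`, with morphisms `q : 𝒴 → X × ℙ¹` and `r : 𝒴 → 𝒳`. -/
structure Resolution {P : PolarisedVariety n} (T : TestConfiguration P) where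
  Y : CSch
  [isVariety : IsVariety Y]
  proper : IsProper Y.hom
  smooth : Smooth Y.hom
  projective : ∃ A : LineBundle Y.left, A.IsAmple
  q : Y ⟶ P.XP
  r : Y ⟶ T.tot
  birational : ∃ W : P.XP.left.Opens, (W : Set P.XP.left).Nonempty ∧ IsIso (q.left ∣_ W)
  compat : (q.left ∣_ P.V) ≫ T.triv.left = (q.left ⁻¹ᵁ P.V).ι ≫ r.left
  overP1 : q ≫ prod.snd P.X P1 = r ≫ T.π
  σ : prod Gm Y ⟶ Y
  isAction : IsAction σ
  q_fst_equivariant : ∀ c p,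
    (actPt σ c p).map (q ≫ prod.fst P.X P1) = p.map (q ≫ prod.fst P.X P1)
  q_snd_equivariant : ∀ c p,
    IsScaled c (p.map (q ≫ prod.snd P.X P1)) ((actPt σ c p).map (q ≫ prod.snd P.X P1))
  r_equivariant : ∀ c p, (actPt σ c p).map r = actPt T.σ c (p.map r)

attribute [instance] Resolution.isVariety

/-- The morphism `𝒴 → X`. -/
def Resolution.toX {P : PolarisedVariety n} {T : TestConfiguration P} (R : Resolution T) :
    R.Y ⟶ P.X :=
  R.q ≫ prod.fst P.X P1

/-! ### Central charges -/

/-- The data of a polynomial central charge on `X`: a stability vector `ρ₀, …, ρₙ`, the coefficients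
`a₀, …, aₙ` of a polynomial Chern form (values of `ρ`, `a` at integers `> n` play no role), and a
unipotent cohomology class `Θ = 1 + Θ₁ + Θ₂ + ⋯`, `Θⱼ ∈ H^{2j}(X, ℂ)`. -/
structure CentralCharge (P : PolarisedVariety n) where
  ρ : ℕ → ℂ
  ρ_top : ρ n = Complex.I
  a : ℕ → ℂ
  a_zero : a 0 = 1
  a_one : a 1 = 1
  Θ : ∀ j, Coh (ComplexPts P.X) (2 * j)
  Θ_zero : Θ 0 = Coh.one _

variable {P : PolarisedVariety n}

/-- `∫_X L^l · K_X^j · θ`, for `θ` of degree `2d`, `l + j + d = n`. -/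
def intX (P : PolarisedVariety n) (l j : ℕ) {d : ℕ} (θ : Coh (ComplexPts P.X) (2 * d)) : ℂ :=
  pairing P.X (List.replicate l P.L ++ List.replicate j P.K) θ

/-- `∫_𝒳 ℒ^l · K_{𝒳/ℙ¹}^j · θ`, for `θ` of degree `2d` on `X`, `l + j + d = n + 1`; as usual the
intersection number is computed on a resolution of indeterminacy `𝒴`. -/
def intT {T : TestConfiguration P} (R : Resolution T) (l j : ℕ) {d : ℕ}
    (θ : Coh (ComplexPts P.X) (2 * d)) : ℂ :=
  pairing R.Y
    (List.replicate l (T.L.pullback R.r.left) ++ List.replicate j (T.relK.pullback R.r.left))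
    (Coh.pull (ComplexPts.mapC R.toX) (2 * d) θ)

namespace CentralCharge

/-- `Z_k(X, L) = ∑ₗ ρₗ k^l ∫_X L^l · f(K_X) · Θ`, where `f(K_X) = ∑ⱼ aⱼ K_X^j`. -/
def Zk (Z : CentralCharge P) (k : ℕ) : ℂ :=
  ∑ l ∈ Finset.range (n + 1), Z.ρ l * (k : ℂ) ^ l *
    ∑ j ∈ Finset.range (n - l + 1), Z.a j * intX P l j (Z.Θ (n - l - j))

/-- `Z_k(𝒳, ℒ) = ∑ₗ ρₗ k^l / (l + 1) ∫_𝒳 ℒ^{l+1} · f(K_{𝒳/ℙ¹}) · Θ`. -/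
def ZkT (Z : CentralCharge P) {T : TestConfiguration P} (R : Resolution T) (k : ℕ) : ℂ :=
  ∑ l ∈ Finset.range (n + 1), Z.ρ l * (k : ℂ) ^ l / (l + 1) *
    ∑ j ∈ Finset.range (n - l + 1), Z.a j * intT R (l + 1) j (Z.Θ (n - l - j))

/-- Asymptotic `Z`-semistability of `(X, L)`. -/
def AsymptoticallySemistable (Z : CentralCharge P) : Prop :=
  ∀ (T : TestConfiguration P) (R : Resolution T),
    ∀ᶠ k : ℕ in atTop, 0 ≤ (Z.ZkT R k / Z.Zk k).im

/-- `Z` is non-degenerate. -/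
def IsNondegenerate (Z : CentralCharge P) : Prop :=
  (Z.ρ (n - 1)).re < 0 ∧ Z.Θ 1 = 0

/-- `Z` is of map type, with respect to the map `p : X → Y` and the ample line bundle `H` on `Y`:
`Θ` is the pullback of a class on `Y`, and `Θ₁` is the class of `p^* H`. -/
def IsMapType (Z : CentralCharge P) {Y : CSch} (p : P.X ⟶ Y) (H : QLineBundle Y.left) : Prop :=
  (Z.ρ (n - 1)).re < 0 ∧
  (∃ β : ∀ j, Coh (ComplexPts Y) (2 * j), ∀ j,
    Z.Θ j = Coh.pull (ComplexPts.mapC p) (2 * j) (β j)) ∧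
  Z.Θ 1 = qChernClass (H.pullback p.left)

end CentralCharge

/-! ### K-semistability -/

/-- The intersection number `L^n`. -/
def PolarisedVariety.volume (P : PolarisedVariety n) : ℝ :=
  number P.X (List.replicate n P.L)

/-- The slope `μ(X, L) = -K_X · L^{n-1} / L^n`. -/
def PolarisedVariety.slope (P : PolarisedVariety n) : ℝ :=
  -number P.X (List.replicate (n - 1) P.L ++ [P.K]) / P.volume

/-- The Donaldson–Futaki invariant
`DF(𝒳, ℒ) = n μ(X, L) / (n + 1) ℒ^{n+1} + ℒ^n · K_{𝒳/ℙ¹}`. -/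
def DF {T : TestConfiguration P} (R : Resolution T) : ℝ :=
  n * P.slope / (n + 1) * number R.Y (List.replicate (n + 1) (T.L.pullback R.r.left)) +
    number R.Y (List.replicate n (T.L.pullback R.r.left) ++ [T.relK.pullback R.r.left])

/-- K-semistability of `(X, L)`. -/
def KSemistable (P : PolarisedVariety n) : Prop :=
  ∀ (T : TestConfiguration P) (R : Resolution T), 0 ≤ DF R

variable {Y : CSch}

/-- The slope of a map `p : (X, L) → (Y, H)`: `-(K_X + p^*H) · L^{n-1} / L^n`. -/
def slopeMap (p : P.X ⟶ Y) (H : QLineBundle Y.left) : ℝ :=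
  P.slope - (intX P (n - 1) 0 (d := 1) (qChernClass (H.pullback p.left))).re / P.volume

/-- The Donaldson–Futaki invariant for the map `p`:
`n μ_p / (n + 1) ℒ^{n+1} + ℒ^n · (K_{𝒳/ℙ¹} + p^*H)`. -/
def DFMap (p : P.X ⟶ Y) (H : QLineBundle Y.left) {T : TestConfiguration P} (R : Resolution T) : ℝ :=
  n * slopeMap p H / (n + 1) * number R.Y (List.replicate (n + 1) (T.L.pullback R.r.left)) +
    number R.Y (List.replicate n (T.L.pullback R.r.left) ++ [T.relK.pullback R.r.left]) +
    (intT R n 0 (d := 1) (qChernClass (H.pullback p.left))).re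

/-- K-semistability of the map `p : (X, L) → (Y, H)`. All test configurations for `(X, L)` are
allowed, `p^*H` being pulled back to `𝒴`; when `p` extends to a morphism `𝒳 → Y`, this is the same
as the pullback of `H` under the extension. -/
def KSemistableMap (p : P.X ⟶ Y) (H : QLineBundle Y.left) : Prop :=
  ∀ (T : TestConfiguration P) (R : Resolution T), 0 ≤ DFMap p H R

end TestConfigurations

end ZStability

end

open ZStability

/-! Both central charges are polynomials in `k` of degree at most `n`, and only their two top
coefficients matter. On `X` these are `i V`, with `V = L^n`, and `ρ_{n-1} (κ + θ)`, with `κ =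
L^{n-1}·K_X` and `θ = L^{n-1}·Θ₁`. On the test configuration they are `i A / (n+1)`, with `A =
ℒ^{n+1}`, and `(ρ_{n-1} / n) (B + θ')`, with `B = ℒ^n·K_{𝒳/ℙ¹}` and `θ' = ℒ^n·Θ₁`. If `θ` and `θ'`
are real, the quotient tends to a real number, and its `k⁻¹` coefficient is `-i ρ_{n-1}` times the
real number `DF / (n V)`, where `DF` includes the `Θ₁` terms. Taking imaginary parts gives the
expansion (`expansion_coefficient`, `CentralCharge.im_isBigO`). Multiplying it by `k` and letting `k
→ ∞` gives `DF ≥ 0` under semistability, because `V > 0` and `Re ρ_{n-1} < 0`.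

The geometric inputs concern the intersection numbers. First, `V > 0`
(`PolarisedVariety.volume_pos`), by induction on dimension: some power of `L` has a regular section
on each subvariety, its divisor is effective, and it has a component from which a chain of
specializations one step shorter starts. That the divisor is not empty rests on properness: regular
functions on a complete variety are constant (`exists_constants_eq`), so a complete subvariety of an
affine open set is a point. The bound on codimension is Krull's principal ideal theorem
(`exists_chain_of_mem_last`).

Second, the leading terms use `Θ₀ = 1`, whose integral over a point is 1 (`integral_zero_one`), so
that they are the algebraic intersection numbers. Third, `θ` and `θ'` are real: they vanish if `Θ₁ =
0`, and for a Chern class the integral over a curve is a rational degree up to the denominator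
(`intX_qChernClass`, `intT_qChernClass`). -/

namespace ZStability

/-! ### Local rings of subvarieties, and generizations of a point as primes of its stalk. -/

section LocalRings

variable {X : Scheme.{0}} {w x y z : X}

/-- The map from the local ring at `y` to the function field of the subvariety with generic point
`x`. -/
noncomputable def toResidue (h : x ⤳ y) : X.presheaf.stalk y →+* X.residueField x :=
  (X.presheaf.stalkSpecializes h ≫ X.residue x).hom

theorem toResidue_mem (h : x ⤳ y) (g : X.presheaf.stalk y) : toResidue h g ∈ localRing h :=
  ⟨g, rfl⟩

theorem toResidue_stalkSpecializes (h : x ⤳ y) (h' : y ⤳ z) (g : X.presheaf.stalk z) :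
    toResidue h (X.presheaf.stalkSpecializes h' g) = toResidue (h.trans h') g := by
  simp only [toResidue, CommRingCat.hom_comp, RingHom.comp_apply]
  congr 1
  rw [← CommRingCat.comp_apply, TopCat.Presheaf.stalkSpecializes_comp]

theorem toResidue_germ (h : x ⤳ y) {U : X.Opens} (hy : y ∈ U) (f : Γ(X, U)) :
    toResidue h (X.presheaf.germ U y hy f) = X.evaluation U x (h.mem_open U.isOpen hy) f := by
  simp only [toResidue, CommRingCat.hom_comp, RingHom.comp_apply]
  erw [TopCat.Presheaf.germ_stalkSpecializes_apply]
  rfl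

theorem localRing_antitone (h : x ⤳ y) (h' : y ⤳ z) : localRing (h.trans h') ≤ localRing h := by
  rintro _ ⟨g, rfl⟩
  exact ⟨X.presheaf.stalkSpecializes h' g, toResidue_stalkSpecializes h h' g⟩

theorem toResidue_refl_eq_zero_iff (g : X.presheaf.stalk y) :
    toResidue (specializes_refl y) g = 0 ↔ ¬ IsUnit g := by
  simp only [toResidue, TopCat.Presheaf.stalkSpecializes_refl, Category.id_comp]
  exact IsLocalRing.residue_eq_zero_iff g

theorem isUnit_stalkSpecializes_iff (h : y ⤳ z) (g : X.presheaf.stalk z) :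
    IsUnit (X.presheaf.stalkSpecializes h g) ↔ toResidue h g ≠ 0 := by
  rw [← not_iff_not, ← toResidue_refl_eq_zero_iff, toResidue_stalkSpecializes, not_not]

/-- If `g'` maps to the inverse of the image of `g`, then `1 - g g'` maps to zero and is not a unit;
since the stalk is local, `g g'`, and hence `g`, is a unit. -/
theorem isUnit_iff_inv_mem_localRing (h : x ⤳ y) (g : X.presheaf.stalk y) :
    IsUnit g ↔ toResidue h g ≠ 0 ∧ (toResidue h g)⁻¹ ∈ localRing h := by
  constructor
  · intro hg
    refine ⟨(hg.map (toResidue h)).ne_zero, ?_⟩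
    obtain ⟨g, rfl⟩ := hg
    exact ⟨(g⁻¹ : (X.presheaf.stalk y)ˣ), (map_units_inv (toResidue h) g)⟩
  · rintro ⟨h0, g', hg'⟩
    by_contra hg
    have h1 : IsUnit (1 - g * g') := by
      by_contra h2
      have := IsLocalRing.nonunits_add (a := 1 - g * g') (b := g * g') h2
        (fun h3 => hg (isUnit_of_mul_isUnit_left h3))
      exact this (by simp)
    refine (h1.map (toResidue h)).ne_zero ?_
    rw [map_sub, map_mul, map_one, show toResidue h g' = _ from hg', mul_inv_cancel₀ h0, sub_self]

theorem inv_mem_localRing_iff (h : x ⤳ y) (h' : y ⤳ z) (g : X.presheaf.stalk z) :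
    toResidue (h.trans h') g ≠ 0 ∧ (toResidue (h.trans h') g)⁻¹ ∈ localRing h ↔
      toResidue h' g ≠ 0 := by
  rw [← toResidue_stalkSpecializes h h']
  exact (isUnit_iff_inv_mem_localRing h _).symm.trans (isUnit_stalkSpecializes_iff h' g)

theorem specMap_toResidue_fromSpecStalk (h : x ⤳ y) :
    Spec.map (CommRingCat.ofHom (toResidue h)) ≫ X.fromSpecStalk y = X.fromSpecResidueField x := by
  simp only [toResidue, CommRingCat.ofHom_hom, Spec.map_comp, Category.assoc,
    Scheme.SpecMap_stalkSpecializes_fromSpecStalk]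
  rfl

/-- The generization of `z` which corresponds to a prime of the local ring at `z`. -/
noncomputable def pointOfPrime (z : X) (q : PrimeSpectrum (X.presheaf.stalk z)) : X :=
  (X.fromSpecStalk z) (q : Spec (X.presheaf.stalk z))

theorem pointOfPrime_injective : Function.Injective (pointOfPrime z) :=
  (X.fromSpecStalk z).isEmbedding.injective

/-- The morphism from the spectrum of the residue field at `y` to `X` factors through the spectrum
of the stalk at `z`, where its image is this kernel. -/
theorem pointOfPrime_ker_toResidue (h : y ⤳ z) :
    pointOfPrime z ⟨RingHom.ker (toResidue h), RingHom.ker_isPrime _⟩ = y := by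
  have h1 := Scheme.fromSpecResidueField_apply y (IsLocalRing.closedPoint (X.residueField y))
  rw [← specMap_toResidue_fromSpecStalk h] at h1
  refine Eq.trans (congrArg (pointOfPrime z) ?_) h1
  ext g
  change toResidue h g = 0 ↔ toResidue h g ∈ IsLocalRing.maximalIdeal _
  rw [IsLocalRing.mem_maximalIdeal, mem_nonunits_iff, isUnit_iff_ne_zero, not_not]

theorem pointOfPrime_specializes (q : PrimeSpectrum (X.presheaf.stalk z)) :
    pointOfPrime z q ⤳ z := by
  have : pointOfPrime z q ∈ Set.range (X.fromSpecStalk z) := ⟨q, rfl⟩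
  rwa [Scheme.range_fromSpecStalk] at this

theorem ker_toResidue {q : PrimeSpectrum (X.presheaf.stalk z)} (h : pointOfPrime z q ⤳ z) :
    RingHom.ker (toResidue h) = q.asIdeal :=
  congrArg PrimeSpectrum.asIdeal (pointOfPrime_injective (pointOfPrime_ker_toResidue h))

theorem exists_prime_of_specializes (h : y ⤳ z) :
    ∃ q : PrimeSpectrum (X.presheaf.stalk z), pointOfPrime z q = y :=
  ⟨_, pointOfPrime_ker_toResidue h⟩

theorem pointOfPrime_specializes_iff {q q' : PrimeSpectrum (X.presheaf.stalk z)} :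
    pointOfPrime z q ⤳ pointOfPrime z q' ↔ q ≤ q' :=
  (X.fromSpecStalk z).isEmbedding.isInducing.specializes_iff.trans
    (PrimeSpectrum.le_iff_specializes q q').symm

end LocalRings

/-! ### Regular functions on complete varieties are constant. -/

section Constants

/-- The inclusion of the constants in the function field of a subvariety. -/
noncomputable def constants (X : CSch) (w : X.left) : ℂ →+* X.left.residueField w :=
  (X.left.residue w).hom.comp (stalkHom X w)

variable {X : CSch} {w y : X.left}

theorem specMap_constants :
    Spec.map (CommRingCat.ofHom (constants X w)) = X.left.fromSpecResidueField w ≫ X.hom := by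
  simp only [constants, stalkHom, CommRingCat.ofHom_comp, CommRingCat.ofHom_hom, Spec.map_comp,
    Spec.map_preimage, Scheme.fromSpecResidueField, Category.assoc]

/-- The structure morphism to `Spec ℂ` makes the constants factor through every stalk. -/
theorem constants_mem_localRing (h : w ⤳ y) (c : ℂ) : constants X w c ∈ localRing h := by
  have : constants X w = (toResidue h).comp (stalkHom X y) := by
    have key : CommRingCat.ofHom (constants X w) =
        CommRingCat.ofHom ((toResidue h).comp (stalkHom X y)) := by
      apply Spec.map_injective
      rw [specMap_constants, CommRingCat.ofHom_comp, Spec.map_comp,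
        ← specMap_toResidue_fromSpecStalk h]
      simp only [stalkHom, CommRingCat.ofHom_hom, Spec.map_preimage, Category.assoc]
    exact congrArg CommRingCat.Hom.hom key
  rw [this]
  exact toResidue_mem h _

/-- By the valuative criterion the valuation has a centre on `X`: the image of the closed point
under the lift of `Spec V`. -/
theorem exists_localRing_le_valuationSubring (hX : IsProper X.hom)
    (V : ValuationSubring (X.left.residueField w)) (hV : ∀ c, constants X w c ∈ V) :
    ∃ (y : X.left) (h : w ⤳ y), localRing h ≤ V.toSubring := by
  let ψ : ℂ →+* V := (constants X w).codRestrict V.toSubring hV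
  have sq : X.left.fromSpecResidueField w ≫ X.hom =
      Spec.map (CommRingCat.ofHom (algebraMap V (X.left.residueField w))) ≫
        Spec.map (CommRingCat.ofHom ψ) := by
    rw [← specMap_constants, ← Spec.map_comp]
    rfl
  have hex : ValuativeCriterion.Existence X.hom := by
    have : UniversallyClosed X.hom := inferInstance
    rw [UniversallyClosed.eq_valuativeCriterion] at this
    exact this.1
  obtain ⟨l, hl, -⟩ := (hex { R := V, K := X.left.residueField w, commSq := ⟨sq⟩, .. }).exists_lift
  dsimp only at l hl
  have h1 : l (Spec.map (CommRingCat.ofHom (algebraMap V (X.left.residueField w)))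
      (IsLocalRing.closedPoint (X.left.residueField w))) = w :=
    congr($hl (IsLocalRing.closedPoint (X.left.residueField w))).trans
      (Scheme.fromSpecResidueField_apply _ _)
  have hs : w ⤳ l (IsLocalRing.closedPoint V) := by
    conv_lhs => rw [← h1]
    exact (IsLocalRing.specializes_closedPoint _).map l.continuous
  refine ⟨l (IsLocalRing.closedPoint V), hs, ?_⟩
  have key : CommRingCat.ofHom (toResidue hs) =
      Scheme.stalkClosedPointTo l ≫ CommRingCat.ofHom (algebraMap V (X.left.residueField w)) := by
    apply Spec.map_injective
    rw [← cancel_mono (X.left.fromSpecStalk _), specMap_toResidue_fromSpecStalk, Spec.map_comp,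
      Category.assoc, Scheme.Spec_stalkClosedPointTo_fromSpecStalk, hl]
  rintro _ ⟨g, rfl⟩
  have := congrArg (fun f => f.hom g) key
  change toResidue hs g ∈ V.toSubring
  rw [show toResidue hs g = _ from this]
  exact ((Scheme.stalkClosedPointTo l).hom g).2

/-- On a complete variety, everywhere regular rational functions are constant. -/
theorem exists_constants_eq (hX : IsProper X.hom) {u : X.left.residueField w}
    (hu : ∀ y (h : w ⤳ y), u ∈ localRing h) : ∃ c, constants X w c = u := by
  -- The intersection of all valuation rings containing the constants is their integral closure in
  -- the function field. Every such ring contains a local ring of the subvariety, hence contains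
  -- `u`.
  have h1 : u ∈ (⨅ V : {V : ValuationSubring (X.left.residueField w) //
      Set.range (constants X w) ⊆ V.toSubring}, V.1.toSubring) := by
    simp only [Subring.mem_iInf]
    intro V
    obtain ⟨y, h, hy⟩ := exists_localRing_le_valuationSubring hX V.1 fun c => V.2 ⟨c, rfl⟩
    exact hy (hu y h)
  rw [iInf_valuationSubring_superset] at h1
  have h2 : Subring.closure (Set.range (constants X w)) = (constants X w).range := by
    rw [← RingHom.coe_range, Subring.closure_eq]
  rw [h2] at h1
  have h3 : IsIntegral (constants X w).range u := h1
  let := (constants X w).toAlgebra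
  -- Integrality over the image of `ℂ` is carried to `ℂ` by lifting the monic equation; then
  -- algebraic closedness applies.
  have h4 : IsIntegral ℂ u := by
    obtain ⟨p, hp, hpu⟩ := h3
    have hlift : p ∈ Polynomial.lifts (constants X w).rangeRestrict := by
      rw [Polynomial.mem_lifts]
      exact Polynomial.map_surjective _ (constants X w).rangeRestrict_surjective p
    obtain ⟨q, hq, -, hqm⟩ := Polynomial.lifts_and_degree_eq_and_monic hlift hp
    refine ⟨q, hqm, ?_⟩
    rw [← hq, Polynomial.eval₂_map] at hpu
    exact hpu
  exact minpoly.mem_range_of_degree_eq_one ℂ u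
    (IsAlgClosed.degree_eq_one_of_irreducible ℂ (minpoly.irreducible h4))

end Constants

/-! ### Zeros and restriction of rational sections. -/

section Sections

variable {X : Scheme.{0}} {M : LineBundle X} {w x y z : X}

theorem toResidue_germ₂ (h : x ⤳ y) {U V : X.Opens} (hU : y ∈ U) (hV : y ∈ V) (f : Γ(X, U ⊓ V)) :
    toResidue h (germ₂ f y hU hV) =
      X.evaluation (U ⊓ V) x ⟨h.mem_open U.isOpen hU, h.mem_open V.isOpen hV⟩ f :=
  toResidue_germ h _ f

namespace RatSection

theorem eq_transition_mul (s : RatSection M x) (h : x ⤳ y) {i j : M.ι} (hi : y ∈ M.U i)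
    (hj : y ∈ M.U j) :
    s.s i (h.mem_open (M.U i).isOpen hi) =
      toResidue h (germ₂ (M.g i j) y hi hj) * s.s j (h.mem_open (M.U j).isOpen hj) := by
  rw [toResidue_germ₂]
  exact s.compat i j _ _

theorem inv_eq_transition_mul (s : RatSection M x) (h : x ⤳ y) {i j : M.ι} (hi : y ∈ M.U i)
    (hj : y ∈ M.U j) :
    (s.s i (h.mem_open (M.U i).isOpen hi))⁻¹ =
      toResidue h (germ₂ (M.g j i) y hj hi) * (s.s j (h.mem_open (M.U j).isOpen hj))⁻¹ := by
  rw [s.eq_transition_mul h hj hi]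
  have h0 := s.ne_zero i (h.mem_open (M.U i).isOpen hi)
  have h1 := s.ne_zero j (h.mem_open (M.U j).isOpen hj)
  rw [s.eq_transition_mul h hj hi] at h1
  have h2 := left_ne_zero_of_mul h1
  field_simp

/-- The section has a zero (or a pole) at `y`. -/
def VanishesAt (s : RatSection M x) (h : x ⤳ y) : Prop :=
  ∃ i, ∃ hi : y ∈ M.U i, (s.s i (h.mem_open (M.U i).isOpen hi))⁻¹ ∉ localRing h

theorem vanishesAt_iff (s : RatSection M x) (h : x ⤳ y) {i : M.ι} (hi : y ∈ M.U i) :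
    s.VanishesAt h ↔ (s.s i (h.mem_open (M.U i).isOpen hi))⁻¹ ∉ localRing h := by
  refine ⟨?_, fun h' => ⟨i, hi, h'⟩⟩
  rintro ⟨j, hj, h'⟩ h1
  refine h' ?_
  rw [s.inv_eq_transition_mul h hj hi]
  exact (localRing h).mul_mem (toResidue_mem h _) h1

/-- A single local equation `g` at `z` detects the zeros at all generizations `y` of `z`: the
section vanishes at `y` exactly when `g` lies in the prime of `y`. -/
theorem vanishesAt_iff_of_eq (s : RatSection M x) (h : x ⤳ y) (h' : y ⤳ z) {i : M.ι}
    (hi : z ∈ M.U i) {g : X.presheaf.stalk z}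
    (hg : toResidue (h.trans h') g = s.s i ((h.trans h').mem_open (M.U i).isOpen hi)) :
    s.VanishesAt h ↔ toResidue h' g = 0 := by
  rw [s.vanishesAt_iff h (h'.mem_open (M.U i).isOpen hi), ← hg, ← not_iff_not, not_not,
    ← ne_eq, ← inv_mem_localRing_iff h h' g]
  refine ⟨fun h1 => ⟨?_, h1⟩, fun h1 => h1.2⟩
  rw [hg]
  exact s.ne_zero _ _

theorem vanishesAt_of_specializes {s : RatSection M x} {h : x ⤳ y}
    (h' : y ⤳ z) (hv : s.VanishesAt h) : s.VanishesAt (h.trans h') := by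
  obtain ⟨i, hi⟩ := M.cover z
  rw [s.vanishesAt_iff _ hi]
  rw [s.vanishesAt_iff h (h'.mem_open (M.U i).isOpen hi)] at hv
  exact fun h1 => hv (localRing_antitone h h' h1)

/-- At the generic point the local ring is the whole function field. -/
theorem not_vanishesAt_self (s : RatSection M x) :
    ¬ s.VanishesAt (specializes_refl x) := by
  rintro ⟨i, hi, h⟩
  refine h ⟨((X.residue_surjective x) (s.s i hi)⁻¹).choose, ?_⟩
  have := ((X.residue_surjective x) (s.s i hi)⁻¹).choose_spec
  simpa only [TopCat.Presheaf.stalkSpecializes_refl, Category.id_comp] using this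

/-- The zero locus of a regular section is closed. -/
theorem IsRegular.isClosed_zeros {s : RatSection M x} (hs : s.IsRegular) :
    IsClosed {y | ∃ h : x ⤳ y, s.VanishesAt h} := by
  rw [← isOpen_compl_iff, isOpen_iff_forall_mem_open]
  intro y hy
  by_cases h : x ⤳ y
  · obtain ⟨i, hi⟩ := M.cover y
    obtain ⟨g, hg⟩ := hs y h i hi
    change toResidue h g = _ at hg
    obtain ⟨U, hyU, f, rfl⟩ := X.presheaf.exists_germ_eq g
    -- Off the zero locus the local equation is a unit germ, so it stays invertible on a basic open
    -- set.
    have hu : IsUnit (X.presheaf.germ U y hyU f) := by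
      rw [← not_not (a := IsUnit _), ← toResidue_refl_eq_zero_iff,
        ← s.vanishesAt_iff_of_eq h (specializes_refl y) hi hg]
      exact fun h' => hy ⟨h, h'⟩
    refine ⟨X.basicOpen f ⊓ M.U i, ?_, (X.basicOpen f ⊓ M.U i).isOpen,
      (X.mem_basicOpen f y hyU).2 hu, hi⟩
    rintro z ⟨hz, hzi⟩ ⟨h', hv⟩
    have hzU : z ∈ U := X.basicOpen_le f hz
    have hz' := (X.mem_basicOpen f z hzU).1 hz
    rw [toResidue_germ] at hg
    rw [s.vanishesAt_iff_of_eq h' (specializes_refl z) hzi (g := X.presheaf.germ U z hzU f)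
      (by rw [toResidue_germ]; exact hg), toResidue_refl_eq_zero_iff] at hv
    exact hv hz'
  · refine ⟨(closure {x})ᶜ, ?_, isClosed_closure.isOpen_compl, ?_⟩
    · rintro z hz ⟨h', -⟩
      exact hz h'.mem_closure
    · exact fun h' => h (specializes_iff_mem_closure.2 h')

theorem ker_toResidue_le (h : x ⤳ y) {g : X.presheaf.stalk y} (hg : toResidue h g = 0) :
    toResidue (specializes_refl y) g = 0 := by
  rw [toResidue_refl_eq_zero_iff]
  exact fun hu => (hu.map (toResidue h)).ne_zero hg

/-- The restriction to the subvariety with generic point `w` of a regular section which does not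
vanish identically on it. -/
noncomputable def IsRegular.restrict {s : RatSection M x} (hs : s.IsRegular) (h : x ⤳ w)
    (hw : ¬ s.VanishesAt h) : RatSection M w where
  -- The chosen germ at `w` is irrelevant: two germs with the same image at `x` differ by a
  -- non-unit, which dies at `w` (`ker_toResidue_le`).
  s i hi := toResidue (specializes_refl w) (hs w h i hi).choose
  ne_zero i hi := by
    rwa [ne_eq, ← s.vanishesAt_iff_of_eq h (specializes_refl w) hi (hs w h i hi).choose_spec]
  compat i j hi hj := by
    have h1 := toResidue_germ₂ (specializes_refl w) hi hj (M.g i j)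
    rw [← h1, ← map_mul, ← sub_eq_zero, ← map_sub]
    refine ker_toResidue_le h ?_
    rw [map_sub, map_mul, sub_eq_zero]
    refine (hs w h i hi).choose_spec.trans ((s.eq_transition_mul h hi hj).trans ?_)
    congr 1
    exact (hs w h j hj).choose_spec.symm

theorem IsRegular.toResidue_eq_restrict {s : RatSection M x} (hs : s.IsRegular) (h : x ⤳ w)
    (hw : ¬ s.VanishesAt h) (h' : w ⤳ y) {i : M.ι} (hi : y ∈ M.U i) {g : X.presheaf.stalk y}
    (hg : toResidue (h.trans h') g = s.s i ((h.trans h').mem_open (M.U i).isOpen hi)) :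
    toResidue h' g = (hs.restrict h hw).s i (h'.mem_open (M.U i).isOpen hi) := by
  have hwi := h'.mem_open (M.U i).isOpen hi
  change _ = toResidue (specializes_refl w) (hs w h i hwi).choose
  have h1 := toResidue_stalkSpecializes (specializes_refl w) h' g
  rw [← h1, ← sub_eq_zero, ← map_sub]
  refine ker_toResidue_le h ?_
  rw [map_sub, toResidue_stalkSpecializes, hg, sub_eq_zero]
  exact (hs w h i hwi).choose_spec.symm

theorem IsRegular.restrict_vanishesAt_iff {s : RatSection M x} (hs : s.IsRegular) (h : x ⤳ w)
    (hw : ¬ s.VanishesAt h) (h' : w ⤳ y) :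
    (hs.restrict h hw).VanishesAt h' ↔ s.VanishesAt (h.trans h') := by
  obtain ⟨i, hi⟩ := M.cover y
  obtain ⟨g, hg⟩ := hs y (h.trans h') i hi
  rw [s.vanishesAt_iff_of_eq (h.trans h') (specializes_refl y) hi hg,
    (hs.restrict h hw).vanishesAt_iff_of_eq h' (specializes_refl y) hi
      (hs.toResidue_eq_restrict h hw h' hi hg)]

end RatSection

/-- The restriction of a global section to a subvariety on which it does not vanish identically. -/
noncomputable def LineBundle.Section.toRatSection (t : M.Section ⊤) (x : X)
    (hx : ∃ i, ∃ hi : x ∈ M.U i, IsUnit (germ₂ (t.s i) x hi (Opens.mem_top x))) :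
    RatSection M x where
  s i hi := toResidue (specializes_refl x) (germ₂ (t.s i) x hi (Opens.mem_top x))
  ne_zero i hi := by
    obtain ⟨j, hj, hu⟩ := hx
    rw [ne_eq, toResidue_refl_eq_zero_iff, not_not]
    rw [t.compat j i x hj hi (Opens.mem_top x)] at hu
    exact isUnit_of_mul_isUnit_right hu
  compat i j hi hj := by
    have h1 := toResidue_germ₂ (specializes_refl x) hi hj (M.g i j)
    rw [← h1, ← map_mul, t.compat i j x hi hj (Opens.mem_top x)]

theorem LineBundle.Section.toRatSection_s (t : M.Section ⊤)
    (hx : ∃ i, ∃ hi : x ∈ M.U i, IsUnit (germ₂ (t.s i) x hi (Opens.mem_top x))) (h : x ⤳ y)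
    {i : M.ι} (hi : y ∈ M.U i) :
    toResidue h (germ₂ (t.s i) y hi (Opens.mem_top y)) =
      (t.toRatSection x hx).s i (h.mem_open (M.U i).isOpen hi) := by
  change _ = toResidue _ _
  rw [toResidue_germ₂, toResidue_germ₂]

theorem LineBundle.Section.toRatSection_isRegular (t : M.Section ⊤)
    (hx : ∃ i, ∃ hi : x ∈ M.U i, IsUnit (germ₂ (t.s i) x hi (Opens.mem_top x))) :
    (t.toRatSection x hx).IsRegular :=
  fun _ h _ hi => ⟨_, t.toRatSection_s hx h hi⟩

theorem LineBundle.Section.toRatSection_vanishesAt_iff (t : M.Section ⊤)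
    (hx : ∃ i, ∃ hi : x ∈ M.U i, IsUnit (germ₂ (t.s i) x hi (Opens.mem_top x))) (h : x ⤳ y)
    {i : M.ι} (hi : y ∈ M.U i) :
    (t.toRatSection x hx).VanishesAt h ↔ ¬ IsUnit (germ₂ (t.s i) y hi (Opens.mem_top y)) := by
  rw [RatSection.vanishesAt_iff_of_eq _ h (specializes_refl y) hi (t.toRatSection_s hx h hi),
    toResidue_refl_eq_zero_iff]

/-- Some power of an ample line bundle has a regular section on each subvariety, whose zero locus
is the complement of an affine open set which contains a given point. -/
theorem LineBundle.IsAmple.exists_ratSection (hM : M.IsAmple) (h : x ⤳ y) :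
    ∃ (m : ℕ) (t : RatSection (M.pow m) x) (A : X.Opens), 0 < m ∧ t.IsRegular ∧ IsAffineOpen A ∧
      y ∈ A ∧ ∀ z (h' : x ⤳ z), z ∈ A ↔ ¬ t.VanishesAt h' := by
  obtain ⟨m, t, A, hm, hA, hyA, -, ht⟩ := hM y (Opens.mem_top y)
  obtain ⟨i, hi⟩ := M.cover x
  have hx : ∃ i, ∃ hi : x ∈ (M.pow m).U i, IsUnit (germ₂ (t.s i) x hi (Opens.mem_top x)) :=
    ⟨i, hi, (ht i x hi (Opens.mem_top x)).1 (h.mem_open A.isOpen hyA)⟩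
  refine ⟨m, t.toRatSection x hx, A, hm, t.toRatSection_isRegular hx, hA, hyA, fun z h' => ?_⟩
  obtain ⟨j, hj⟩ := M.cover z
  rw [t.toRatSection_vanishesAt_iff hx h' (i := j) hj, not_not]
  exact ht j z hj (Opens.mem_top z)

end Sections

/-! ### Sections of ample bundles have zeros on complete subvarieties of positive dimension. -/

section Positivity

variable {X : CSch} {M : LineBundle X.left} {w v : X.left}

/-- Used with sections `a = t`, `b = s` and a constant `c`: it writes the inverse of `t` as a
product of elements already known to be regular. -/
theorem inv_eq_pow_mul {K : Type*} [Field K] {a b c : K} {m m' : ℕ} (hm : 0 < m) (ha : a ≠ 0)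
    (hb : b ≠ 0) (hc : c = a ^ m / b ^ m') : a⁻¹ = a ^ (m - 1) * (c⁻¹ * b⁻¹ ^ m') := by
  obtain ⟨k, rfl⟩ := Nat.exists_eq_add_of_le' hm
  rw [hc, Nat.add_sub_cancel, inv_pow]
  field_simp
  exact pow_succ' a k

/-- On a complete variety, two regular sections without zeros of powers of the same line
bundle: if one has no zeros at all, then so does the other. -/
theorem RatSection.not_vanishesAt_of_forall (hX : IsProper X.hom) {m m' : ℕ} (hm : 0 < m)
    {s : RatSection (M.pow m) w} {t : RatSection (M.pow m') w} (ht : t.IsRegular)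
    (hs : ∀ y (h : w ⤳ y), ¬ s.VanishesAt h) (h : w ⤳ v) :
    ¬ t.VanishesAt h := by
  obtain ⟨i₀, hi₀⟩ := M.cover w
  -- Both `t ^ m` and `s ^ m'` are sections of the power `m m'` of `M`, so their quotient is a
  -- rational function independent of the chart.
  have hg : ∀ {y} (h : w ⤳ y) (i : M.ι) (hi : y ∈ M.U i),
      t.s i (h.mem_open (M.U i).isOpen hi) ^ m / s.s i (h.mem_open (M.U i).isOpen hi) ^ m' =
        t.s i₀ hi₀ ^ m / s.s i₀ hi₀ ^ m' := by
    intro y h i hi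
    have hwi := h.mem_open (M.U i).isOpen hi
    have ht' := t.eq_transition_mul (specializes_refl w) (i := i) (j := i₀) hwi hi₀
    have hs' := s.eq_transition_mul (specializes_refl w) (i := i) (j := i₀) hwi hi₀
    change _ = toResidue _ (germ₂ (M.g i i₀ ^ m') w hwi hi₀) * _ at ht'
    change _ = toResidue _ (germ₂ (M.g i i₀ ^ m) w hwi hi₀) * _ at hs'
    rw [germ₂_pow, map_pow] at ht' hs'
    have h0 := s.ne_zero i hwi
    rw [hs'] at h0
    have h1 := left_ne_zero_of_mul h0
    rw [ht', hs', mul_pow, mul_pow, ← pow_mul, ← pow_mul, mul_comm m' m]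
    exact mul_div_mul_left _ _ (left_ne_zero_of_mul
      (a := toResidue (specializes_refl w) (germ₂ (M.g i i₀) w hwi hi₀) ^ (m * m')) (b := 1)
      (by rw [mul_one, pow_mul]; exact pow_ne_zero _ h1))
  -- The quotient is regular everywhere, since `t` is regular and `s` has no zeros.
  obtain ⟨c, hc⟩ := exists_constants_eq hX (u := t.s i₀ hi₀ ^ m / s.s i₀ hi₀ ^ m') (by
    intro y h
    obtain ⟨i, hi⟩ := M.cover y
    rw [← hg h i hi, div_eq_mul_inv, ← inv_pow]
    refine (localRing h).mul_mem ((localRing h).pow_mem (ht y h i hi) _)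
      ((localRing h).pow_mem ?_ _)
    have := hs y h
    rwa [s.vanishesAt_iff h (i := i) hi, not_not] at this)
  obtain ⟨i, hi⟩ := M.cover v
  have hwi := h.mem_open (M.U i).isOpen hi
  rw [t.vanishesAt_iff h (i := i) hi, not_not]
  have h0 := t.ne_zero i hwi
  have h1 := s.ne_zero i hwi
  rw [← hg h i hi] at hc
  rw [inv_eq_pow_mul hm h0 h1 hc, ← map_inv₀]
  have := hs v h
  rw [s.vanishesAt_iff h (i := i) hi, not_not] at this
  exact (localRing h).mul_mem ((localRing h).pow_mem (ht v h i hi) _)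
    ((localRing h).mul_mem (constants_mem_localRing h _) ((localRing h).pow_mem this _))

/-- A complete subvariety of an affine open set is a point. -/
theorem eq_of_isAffineOpen (hX : IsProper X.hom) {A : X.left.Opens} (hA : IsAffineOpen A)
    (h : ∀ y, w ⤳ y → y ∈ A) (hv : w ⤳ v) : w = v := by
  by_contra hne
  have hvw : ¬ v ⤳ w := fun h' => hne (hv.antisymm h').eq
  have hw : w ∈ A ⊓ ⟨(closure {v})ᶜ, isClosed_closure.isOpen_compl⟩ :=
    ⟨h w (specializes_refl w), fun h' => hvw (specializes_iff_mem_closure.2 h')⟩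
  -- On the affine set some `f` is invertible at `w` but not at `v`. Being regular on the whole
  -- subvariety, `f` is a constant there, nonzero by its value at `w`, hence invertible at `v` too.
  obtain ⟨f, hf, hwf⟩ := hA.exists_basicOpen_le ⟨w, hw.2⟩ hw.1
  have hwA := h w (specializes_refl w)
  obtain ⟨c, hc⟩ := exists_constants_eq hX (u := X.left.evaluation A w hwA f) (by
    intro y hy
    rw [← toResidue_germ hy (h y hy)]
    exact toResidue_mem _ _)
  rw [X.left.mem_basicOpen f w hwA, ← not_not (a := IsUnit _), ← toResidue_refl_eq_zero_iff,
    toResidue_germ (specializes_refl w)] at hwf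
  have hvf : IsUnit (X.left.presheaf.germ A v (h v hv) f) := by
    rw [isUnit_iff_inv_mem_localRing hv, toResidue_germ hv]
    refine ⟨hwf, ?_⟩
    rw [← hc, ← map_inv₀]
    exact constants_mem_localRing hv _
  exact hf ((X.left.mem_basicOpen f v (h v hv)).2 hvf) (subset_closure rfl)

/-- A regular section of a power of an ample line bundle has a zero on each complete subvariety
of positive dimension. -/
theorem RatSection.exists_vanishesAt (hX : IsProper X.hom) (hM : M.IsAmple) {m : ℕ} (hm : 0 < m)
    (s : RatSection (M.pow m) w) (hv : w ⤳ v) (hne : w ≠ v) :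
    ∃ y, ∃ h : w ⤳ y, s.VanishesAt h := by
  by_contra! hcon
  -- If `s` had no zeros, neither would `t`; the subvariety would then lie in the affine set `A`,
  -- the non-vanishing locus of `t`.
  obtain ⟨m', t, A, -, ht, hA, -, htA⟩ := hM.exists_ratSection hv
  exact hne (eq_of_isAffineOpen hX hA (fun y hy => (htA y hy).2
    (RatSection.not_vanishesAt_of_forall hX hm ht hcon hy)) hv)

end Positivity

/-! ### Orders of vanishing of regular sections. -/

section Order

/-- `ordAt` picks some fraction representing `f`. Lengths are additive on products and finite in a
Noetherian domain of dimension at most one, so the choice does not matter. -/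
theorem ordAt_eq {F : Type} [Field F] (R : Subring F) [IsNoetherianRing R] [Ring.KrullDimLE 1 R]
    {f : R} (hf : f ≠ 0) : ordAt R (f : F) = ((Ring.ord R f).toNat : ℤ) := by
  have hex : ∃ ab : R × R, ab.1 ≠ 0 ∧ ab.2 ≠ 0 ∧ (f : F) * ab.2 = ab.1 :=
    ⟨(f, 1), hf, one_ne_zero, by simp⟩
  rw [ordAt, dif_pos hex]
  obtain ⟨h1, h2, h3⟩ := hex.choose_spec
  have h4 : f * hex.choose.2 = hex.choose.1 := Subtype.ext h3
  have h5 : Ring.ord R hex.choose.1 = Ring.ord R f + Ring.ord R hex.choose.2 := by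
    rw [← Ring.ord_mul R (mem_nonZeroDivisors_of_ne_zero h2), h4]
  rw [h5, ENat.toNat_add (Ring.ord_ne_top (mem_nonZeroDivisors_of_ne_zero hf))
    (Ring.ord_ne_top (mem_nonZeroDivisors_of_ne_zero h2))]
  push_cast
  ring

theorem toNat_ord_pos_iff {R : Type*} [CommRing R] [IsDomain R] [IsNoetherianRing R]
    [Ring.KrullDimLE 1 R] {f : R} (hf : f ≠ 0) : 0 < (Ring.ord R f).toNat ↔ ¬ IsUnit f := by
  rw [Nat.pos_iff_ne_zero, ne_eq, ENat.toNat_eq_zero, not_or, Ring.ord, Module.length_eq_zero_iff,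
    Ideal.Quotient.subsingleton_iff, Ideal.span_singleton_eq_top]
  exact and_iff_left (Ring.ord_ne_top (mem_nonZeroDivisors_of_ne_zero hf))

variable {X : Scheme.{0}} {x y : X}

instance isNoetherianRing_localRing [IsLocallyNoetherian X] (h : x ⤳ y) :
    IsNoetherianRing (localRing h) :=
  isNoetherianRing_of_surjective _ _ (toResidue h).rangeRestrict
    (toResidue h).rangeRestrict_surjective

/-- A nonzero prime pulls back to a point between `x` and `y` other than `x`; codimension one forces
it to be `y`, so the prime is maximal. -/
theorem IsCodimOne.krullDimLE (h : IsCodimOne x y) : Ring.KrullDimLE 1 (localRing h.1) := by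
  rw [Ring.krullDimLE_one_iff_of_noZeroDivisors]
  intro I h0 hI
  let φ : X.presheaf.stalk y →+* localRing h.1 := (toResidue h.1).rangeRestrict
  have hφ : Function.Surjective φ := (toResidue h.1).rangeRestrict_surjective
  have hk : RingHom.ker φ = RingHom.ker (toResidue h.1) := RingHom.ker_rangeRestrict _
  let q : PrimeSpectrum (X.presheaf.stalk y) := ⟨I.comap φ, hI.comap φ⟩
  have h1 : x ⤳ pointOfPrime y q := by
    rw [← pointOfPrime_ker_toResidue h.1, pointOfPrime_specializes_iff]
    change RingHom.ker (toResidue h.1) ≤ I.comap φ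
    rw [← hk]
    exact Ideal.comap_mono bot_le
  rcases h.2.2 _ h1 (pointOfPrime_specializes q) with h2 | h2
  · exfalso
    have h3 : q.asIdeal = RingHom.ker φ := by
      rw [hk]
      exact congrArg PrimeSpectrum.asIdeal
        (pointOfPrime_injective (h2.trans (pointOfPrime_ker_toResidue h.1).symm))
    refine h0 (le_bot_iff.1 fun a ha => ?_)
    obtain ⟨b, rfl⟩ := hφ a
    exact h3.le (show b ∈ I.comap φ from ha)
  · have h3 : I.comap φ = IsLocalRing.maximalIdeal _ := by
      have h4 := congrArg PrimeSpectrum.asIdeal (pointOfPrime_injective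
        (h2.trans (pointOfPrime_ker_toResidue (specializes_refl y)).symm))
      refine h4.trans ?_
      ext g
      rw [RingHom.mem_ker, toResidue_refl_eq_zero_iff]
      rfl
    have : (I.comap φ).IsMaximal := h3 ▸ inferInstance
    have h5 := Ideal.map_eq_top_or_isMaximal_of_surjective φ hφ this
    rw [Ideal.map_comap_of_surjective φ hφ] at h5
    exact h5.resolve_left hI.ne_top

theorem RatSection.IsRegular.ord_nonneg [IsLocallyNoetherian X] {M : LineBundle X} {s : RatSection M x} (hs : s.IsRegular)
    (h : IsCodimOne x y) : 0 ≤ s.ord h.1 := by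
  have := h.krullDimLE
  have hm := hs y h.1 _ (M.cover y).choose_spec
  have h0 : (⟨_, hm⟩ : localRing h.1) ≠ 0 := fun h' => s.ne_zero _ _ (congrArg Subtype.val h')
  exact (ordAt_eq (localRing h.1) h0).ge.trans' (Int.natCast_nonneg _)

theorem RatSection.IsRegular.ord_pos_iff [IsLocallyNoetherian X] {M : LineBundle X} {s : RatSection M x}
    (hs : s.IsRegular) (h : IsCodimOne x y) : 0 < s.ord h.1 ↔ s.VanishesAt h.1 := by
  have := h.krullDimLE
  have hm := hs y h.1 _ (M.cover y).choose_spec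
  have h0 : (⟨_, hm⟩ : localRing h.1) ≠ 0 := fun h' => s.ne_zero _ _ (congrArg Subtype.val h')
  have h1 : s.ord h.1 = _ := ordAt_eq (localRing h.1) h0
  rw [h1, Int.natCast_pos, toNat_ord_pos_iff h0, s.vanishesAt_iff h.1 (M.cover y).choose_spec,
    not_iff_not, isUnit_iff_exists_inv]
  have h2 := s.ne_zero _ (h.1.mem_open (M.U _).isOpen (M.cover y).choose_spec)
  constructor
  · rintro ⟨b, hb⟩
    have hb' := congrArg Subtype.val hb
    rw [inv_eq_of_mul_eq_one_right hb']
    exact b.2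
  · intro h'
    exact ⟨⟨_, h'⟩, Subtype.ext (mul_inv_cancel₀ h2)⟩

/-- The zero locus is a finite union of irreducible closed sets. The generic point of one containing
`y` lies between `x` and `y`, and it is not `x`, where the section does not vanish; so it is `y`. -/
theorem RatSection.IsRegular.finite_zeros [NoetherianSpace X] {M : LineBundle X}
    {s : RatSection M x} (hs : s.IsRegular) :
    {y : X | ∃ h : IsCodimOne x y, s.VanishesAt h.1}.Finite := by
  obtain ⟨S, hSf, hSc, hSi, hS⟩ :=
    NoetherianSpace.exists_finite_set_isClosed_irreducible hs.isClosed_zeros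
  have := hSf.to_subtype
  refine (Set.finite_range fun T : S => (hSi T.1 T.2).genericPoint).subset ?_
  rintro y ⟨h, hv⟩
  have hy : y ∈ ⋃₀ S := hS ▸ (show y ∈ {y | ∃ h : x ⤳ y, s.VanishesAt h} from ⟨h.1, hv⟩)
  obtain ⟨T, hT, hyT⟩ := hy
  refine ⟨⟨T, hT⟩, ?_⟩
  have hg := (hSi T hT).isGenericPoint_genericPoint_closure
  rw [(hSc T hT).closure_eq] at hg
  have hgT : (hSi T hT).genericPoint ∈ ⋃₀ S := ⟨T, hT, hg.mem⟩
  rw [← hS] at hgT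
  obtain ⟨h1, h2⟩ := hgT
  rcases h.2.2 _ h1 (hg.specializes hyT) with h3 | h3
  · exfalso
    revert h1 h2
    rw [h3]
    exact fun h1 h2 => s.not_vanishesAt_self h2
  · exact h3

end Order

/-! ### Chains of specializations and Krull's principal ideal theorem. -/

section Dimension

variable {X : Scheme.{0}} {x y : X}

/-- There is a chain of `d` proper specializations which starts at `x`, that is, the subvariety with
generic point `x` has dimension at least `d`. -/
def HasChain (d : ℕ) (x : X) : Prop :=
  ∃ c : ℕ → X, c 0 = x ∧ ∀ i < d, c i ⤳ c (i + 1) ∧ c i ≠ c (i + 1)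

theorem specializes_of_le {c : ℕ → X} {d : ℕ} (hc : ∀ i < d, c i ⤳ c (i + 1)) {i j : ℕ}
    (hij : i ≤ j) (hj : j ≤ d) : c i ⤳ c j := by
  induction j, hij using Nat.le_induction with
  | base => exact specializes_refl _
  | succ j hij ih => exact (ih (by omega)).trans (hc j (by omega))

/-- Let `f` vanish at the end, but not at the beginning, of a chain of primes. Then there
is a prime which contains `f`, lies immediately above the beginning of the chain, and is the
beginning of a chain whose length is less by one. -/
theorem exists_chain_of_mem_last {R : Type*} [CommRing R] [IsNoetherianRing R]
    (p : LTSeries (PrimeSpectrum R)) {f : R} (hl : f ∈ p.last.asIdeal)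
    (hh : f ∉ p.head.asIdeal) :
    ∃ (Q : LTSeries (PrimeSpectrum R)) (q : PrimeSpectrum R), Q.length = p.length ∧ q ≤ Q 1 ∧
      f ∈ q.asIdeal ∧ p.head < q ∧ ∀ r, p.head ≤ r → r ≤ q → r = p.head ∨ r = q := by
  -- The chain is replaced by one of the same length and the same beginning in which `f` already
  -- lies in the second prime.
  obtain ⟨Q, hfQ, hlen, hhead, -⟩ := PrimeSpectrum.exist_ltSeries_mem_one_of_mem_last p hl
  have hQ1 : p.head ≤ Q 1 := by
    rw [hhead]
    exact LTSeries.monotone Q (Fin.zero_le _)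
  obtain ⟨q, hq, hqQ⟩ := Ideal.exists_minimalPrimes_le
    (show p.head.asIdeal ⊔ Ideal.span {f} ≤ (Q 1).asIdeal from
      sup_le hQ1 ((Ideal.span_singleton_le_iff_mem _).2 hfQ))
  have hle : p.head.asIdeal ≤ q := le_sup_left.trans hq.1.2
  have hfq : f ∈ q := hq.1.2 (Ideal.mem_sup_right (Ideal.mem_span_singleton_self f))
  have hqp : q.IsPrime := hq.1.1
  refine ⟨Q, ⟨q, hqp⟩, hlen.symm, hqQ, hfq, lt_of_le_of_ne hle ?_, fun r hr hrq => ?_⟩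
  · intro h
    exact hh (by rw [h]; exact hfq)
  · by_contra! hcon
    -- Krull's theorem bounds by one the height of `q` modulo the first prime; a prime strictly in
    -- between would make it at least two.
    have hht := Ideal.map_height_le_one_of_mem_minimalPrimes hq
    let π := Ideal.Quotient.mk p.head.asIdeal
    have hπ : Function.Surjective π := Ideal.Quotient.mk_surjective
    have hker : RingHom.ker π = p.head.asIdeal := Ideal.mk_ker
    have hlift : ∀ {I : Ideal R}, p.head.asIdeal ≤ I → (I.map π).comap π = I := by
      intro I hI
      rw [Ideal.comap_map_of_surjective' π hπ, hker, sup_eq_left]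
      exact hI
    have : (q.map π).IsPrime := Ideal.map_isPrime_of_surjective hπ (hker.le.trans hle)
    have : (r.asIdeal.map π).IsPrime := Ideal.map_isPrime_of_surjective hπ (hker.le.trans hr)
    have h1 : r.asIdeal.map π < q.map π := by
      refine lt_of_le_of_ne (Ideal.map_mono hrq) fun h => hcon.2 (PrimeSpectrum.ext ?_)
      rw [← hlift hr, h, hlift hle]
    have h2 : (⊥ : Ideal (R ⧸ p.head.asIdeal)) < r.asIdeal.map π := by
      refine lt_of_le_of_ne bot_le fun h => hcon.1 (PrimeSpectrum.ext ?_)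
      rw [← hlift hr, ← h]
      exact hker
    have h3 := (Ideal.height_le_iff (n := 1)).1 hht _ this h1
    exact h2.ne' (Ideal.height_eq_zero_iff_eq_bot.1 (Order.lt_one_iff.1 h3))

end Dimension

/-! ### Codimension-one zeros at the start of long chains. -/

section Chains

variable {X : Scheme.{0}} {x y z : X}

theorem mem_asIdeal_iff {q : PrimeSpectrum (X.presheaf.stalk z)} (hq : pointOfPrime z q = y)
    (h : y ⤳ z) (g : X.presheaf.stalk z) : g ∈ q.asIdeal ↔ toResidue h g = 0 := by
  subst hq
  rw [← ker_toResidue h, RingHom.mem_ker]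

/-- The chain becomes a chain of primes in the stalk at its end `z`, where the section has a local
equation to which `exists_chain_of_mem_last` applies. -/
theorem RatSection.IsRegular.exists_isCodimOne_of_chain [IsLocallyNoetherian X] {M : LineBundle X}
    {s : RatSection M x} (hs : s.IsRegular) {d : ℕ} {c : ℕ → X} (hc0 : c 0 = x)
    (hc : ∀ i < d + 1, c i ⤳ c (i + 1) ∧ c i ≠ c (i + 1)) (h : x ⤳ c (d + 1))
    (hv : s.VanishesAt h) :
    ∃ (y : X) (h : IsCodimOne x y), s.VanishesAt h.1 ∧ HasChain d y := by
  generalize hz : c (d + 1) = z at h hv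
  have hcz : ∀ i ≤ d + 1, c i ⤳ z := fun i hi =>
    hz ▸ specializes_of_le (fun j hj => (hc j hj).1) hi le_rfl
  choose q hq using fun i : Fin (d + 1 + 1) =>
    exists_prime_of_specializes (hcz i (Nat.lt_succ_iff.1 i.2))
  let p : LTSeries (PrimeSpectrum (X.presheaf.stalk z)) :=
    { length := d + 1
      toFun := q
      step := fun i => by
        have h1 := hc i i.2
        change q i.castSucc < q i.succ
        refine lt_of_le_of_ne ?_ fun h2 => h1.2 ?_
        · rw [← pointOfPrime_specializes_iff, hq, hq]
          exact h1.1
        · have h3 := congrArg (pointOfPrime z) h2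
          rwa [hq, hq] at h3 }
  have hhead : pointOfPrime z p.head = x := (hq 0).trans hc0
  have hlast : pointOfPrime z p.last = z := (hq (Fin.last _)).trans hz
  obtain ⟨i, hi⟩ := M.cover z
  obtain ⟨g, hg⟩ := hs z h i hi
  change toResidue h g = _ at hg
  obtain ⟨Q, r, hlen, hrQ, hgr, hlt, hmin⟩ := exists_chain_of_mem_last p (f := g)
    (by
      rw [mem_asIdeal_iff hlast (specializes_refl z)]
      exact (s.vanishesAt_iff_of_eq h (specializes_refl z) hi hg).1 hv)
    (by
      rw [mem_asIdeal_iff hhead h, hg]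
      exact s.ne_zero _ _)
  have hxr : x ⤳ pointOfPrime z r := by
    rw [← hhead, pointOfPrime_specializes_iff]
    exact hlt.le
  refine ⟨pointOfPrime z r, ⟨hxr, ?_, ?_⟩, ?_, ?_⟩
  · rw [← hhead]
    exact fun h => hlt.ne (pointOfPrime_injective h)
  · intro w hw hwr
    obtain ⟨t, rfl⟩ := exists_prime_of_specializes (hwr.trans (pointOfPrime_specializes r))
    rw [← hhead, pointOfPrime_specializes_iff] at hw
    rw [pointOfPrime_specializes_iff] at hwr
    rw [← hhead]
    exact (hmin t hw hwr).imp (congrArg _) (congrArg _)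
  · rw [s.vanishesAt_iff_of_eq hxr (pointOfPrime_specializes r) hi hg,
      ← mem_asIdeal_iff rfl]
    exact hgr
  · have hQlen : Q.length = d + 1 := hlen
    -- `e` lists `Q 1, …, Q (d + 1)`, constant afterwards. Replacing `Q 1` by the smaller prime `r`
    -- gives `d` strict steps starting at `r`.
    let e : ℕ → PrimeSpectrum (X.presheaf.stalk z) := fun j =>
      Q ⟨min (j + 1) Q.length, by omega⟩
    have he : ∀ j < d, e j < e (j + 1) := fun j hj => LTSeries.strictMono Q (by
      rw [Fin.lt_def]
      dsimp only
      omega)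
    have he0 : r ≤ e 0 := by
      refine hrQ.trans (le_of_eq (congrArg Q (Fin.ext ?_)))
      dsimp only
      rw [Fin.val_one', hQlen]
      simp [Nat.mod_eq_of_lt]
    refine ⟨fun j => pointOfPrime z (if j = 0 then r else e j), by simp, fun j hj => ?_⟩
    have hlt : (if j = 0 then r else e j) < e (j + 1) := by
      split_ifs with h0
      · subst h0
        exact he0.trans_lt (he 0 hj)
      · exact he j hj
    simp only [Nat.succ_ne_zero, if_false]
    exact ⟨pointOfPrime_specializes_iff.2 hlt.le, fun h => hlt.ne (pointOfPrime_injective h)⟩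

end Chains

/-! ### Positivity of top self-intersections of ample line bundles. -/

section Positivity

variable {X : CSch} {x : X.left}

theorem RatSection.IsRegular.exists_isCodimOne [IsLocallyNoetherian X.left] (hX : IsProper X.hom)
    {M : LineBundle X.left} (hM : M.IsAmple) {m : ℕ} (hm : 0 < m) {s : RatSection (M.pow m) x}
    (hs : s.IsRegular) {d : ℕ} (hd : HasChain (d + 1) x) :
    ∃ (y : X.left) (h : IsCodimOne x y), s.VanishesAt h.1 ∧ HasChain d y := by
  obtain ⟨c, rfl, hc⟩ := hd
  have hsp : c 0 ⤳ c d :=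
    specializes_of_le (d := d + 1) (fun j hj => (hc j hj).1) (Nat.zero_le _) (Nat.le_succ d)
  obtain ⟨hd1, hd2⟩ := hc d (Nat.lt_succ_self d)
  -- The last point of the chain is exchanged for a zero of `s`: either `s` vanishes at `c d` and so
  -- at `c (d + 1)`, or its restriction to the subvariety of `c d`, which has positive dimension,
  -- vanishes somewhere.
  obtain ⟨z, hz, hne, hv⟩ : ∃ z, ∃ h : c d ⤳ z, c d ≠ z ∧ s.VanishesAt (hsp.trans h) := by
    by_cases hv : s.VanishesAt hsp
    · exact ⟨_, hd1, hd2, s.vanishesAt_of_specializes hd1 hv⟩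
    · obtain ⟨z, h, hz⟩ := RatSection.exists_vanishesAt hX hM hm (hs.restrict hsp hv) hd1 hd2
      refine ⟨z, h, ?_, (hs.restrict_vanishesAt_iff hsp hv h).1 hz⟩
      rintro rfl
      exact (hs.restrict hsp hv).not_vanishesAt_self hz
  refine hs.exists_isCodimOne_of_chain (d := d) (c := fun i => if i ≤ d then c i else z) (by simp)
    (fun i hi => ?_) (by simpa using hsp.trans hz) (by simpa using hv)
  rcases (Nat.lt_succ_iff.1 hi).eq_or_lt with rfl | hlt
  · simpa using ⟨hz, hne⟩
  · simpa [hlt.le, Nat.succ_le_iff.2 hlt] using hc i hi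

/-- Ampleness supplies a regular section of a positive power, so `divisor` takes its effective
branch. -/
theorem LineBundle.IsAmple.exists_divisor_eq {M : LineBundle X.left} (hM : M.IsAmple)
    (x : X.left) :
    ∃ (m : ℕ) (s : RatSection (M.pow m) x), 0 < m ∧ s.IsRegular ∧
      ∀ y (h : x ⤳ y), divisor M x y = (s.ord h : ℚ) / m := by
  have hex : ∃ a : (Σ m : ℕ, RatSection (M.pow m) x), 0 < a.1 ∧ a.2.IsRegular := by
    obtain ⟨m, t, -, hm, ht, -⟩ := hM.exists_ratSection (specializes_refl x)
    exact ⟨⟨m, t⟩, hm, ht⟩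
  refine ⟨hex.choose.1, hex.choose.2, hex.choose_spec.1, hex.choose_spec.2, fun y h => ?_⟩
  rw [divisor, dif_pos h, dif_pos hex]

theorem LineBundle.IsAmple.divisor_nonneg [IsLocallyNoetherian X.left] {M : LineBundle X.left}
    (hM : M.IsAmple) {x y : X.left} (h : IsCodimOne x y) : 0 ≤ divisor M x y := by
  obtain ⟨m, s, -, hs, hd⟩ := hM.exists_divisor_eq x
  rw [hd y h.1]
  exact div_nonneg (Int.cast_nonneg (hs.ord_nonneg h)) (Nat.cast_nonneg _)

variable {L : QLineBundle X.left}

theorem QLineBundle.IsAmple.intersection_nonneg [IsLocallyNoetherian X.left] (hL : L.IsAmple) (d : ℕ)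
    (x : X.left) : 0 ≤ intersection (List.replicate d L) x := by
  induction d generalizing x with
  | zero => exact zero_le_one
  | succ d ih =>
    exact finsum_nonneg fun y => mul_nonneg
      (div_nonneg (LineBundle.IsAmple.divisor_nonneg hL y.2) (Nat.cast_nonneg _)) (ih _)

/-- The top self-intersection number of an ample line bundle is positive. -/
theorem QLineBundle.IsAmple.intersection_pos [IsLocallyNoetherian X.left]
    [NoetherianSpace X.left] (hX : IsProper X.hom) (hL : L.IsAmple) {d : ℕ} {x : X.left}
    (hd : HasChain d x) : 0 < intersection (List.replicate d L) x := by
  induction d generalizing x with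
  | zero => exact zero_lt_one
  | succ d ih =>
    obtain ⟨m, s, hm, hs, hdiv⟩ := LineBundle.IsAmple.exists_divisor_eq hL x
    have hLm : (0 : ℚ) < L.m := Nat.cast_pos.2 L.pos
    have hm' : (0 : ℚ) < m := Nat.cast_pos.2 hm
    refine finsum_pos (fun y => mul_nonneg
      (div_nonneg (LineBundle.IsAmple.divisor_nonneg hL y.2) hLm.le)
      (hL.intersection_nonneg d y)) ?_ ?_
    · obtain ⟨y, hy, hv, hyd⟩ := hs.exists_isCodimOne hX hL hm hd
      refine ⟨⟨y, hy⟩, mul_pos (div_pos ?_ hLm) (ih hyd)⟩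
      rw [hdiv y hy.1]
      exact div_pos (Int.cast_pos.2 ((hs.ord_pos_iff hy).2 hv)) hm'
    -- Finite support is essential here: otherwise the `finsum` would default to zero.
    · refine (hs.finite_zeros.preimage Subtype.val_injective.injOn).subset fun y hy => ?_
      refine ⟨y.2, (hs.ord_pos_iff y.2).1 (lt_of_le_of_ne (hs.ord_nonneg y.2) fun h => hy ?_)⟩
      simp only [hdiv y y.2.1, ← h, Int.cast_zero, zero_div, zero_smul]

theorem hasChain_genericPoint [IsIntegral X.left] {n : ℕ} (h : n ≤ topologicalKrullDim X.left) :
    HasChain n (genericPoint X.left) := by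
  obtain ⟨l, hl⟩ := Order.le_krullDim_iff.1 h
  -- The chain of closed sets is read downwards, since specialization goes to smaller closures.
  let e : ℕ → IrreducibleCloseds X.left := fun j => l ⟨l.length - j, by omega⟩
  have he : ∀ j < n, e (j + 1) < e j := fun j hj => LTSeries.strictMono l (by
    rw [Fin.lt_def]
    dsimp only
    omega)
  have hg : ∀ S : IrreducibleCloseds X.left,
      IsGenericPoint S.isIrreducible.genericPoint (S : Set X.left) :=
    fun S => S.isIrreducible.isGenericPoint_genericPoint S.isClosed
  have hstep : ∀ S T : IrreducibleCloseds X.left, S < T →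
      T.isIrreducible.genericPoint ⤳ S.isIrreducible.genericPoint ∧
        T.isIrreducible.genericPoint ≠ S.isIrreducible.genericPoint := by
    refine fun S T hST => ⟨(hg T).specializes (hST.le (hg S).mem), fun h => hST.ne ?_⟩
    have h1 := (hg S).def
    rw [← h, (hg T).def] at h1
    exact IrreducibleCloseds.ext h1.symm
  refine ⟨fun j => if j = 0 then genericPoint X.left else (e j).isIrreducible.genericPoint,
    by simp, fun j hj => ?_⟩
  have hlt := hstep _ _ (he j hj)
  simp only [Nat.succ_ne_zero, if_false]
  split_ifs with h0
  · refine ⟨genericPoint_specializes _, fun h => hlt.2 ?_⟩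
    rw [← h]
    have h1 := hlt.1
    rw [← h] at h1
    exact (h1.antisymm (genericPoint_specializes _)).eq
  · exact hlt

theorem isLocallyNoetherian_of_isVariety (X : CSch) [IsVariety X] : IsLocallyNoetherian X.left :=
  LocallyOfFiniteType.isLocallyNoetherian X.hom

theorem noetherianSpace_of_isVariety (X : CSch) [IsVariety X] : NoetherianSpace X.left := by
  have := isLocallyNoetherian_of_isVariety X
  have : CompactSpace X.left := QuasiCompact.compactSpace_of_compactSpace X.hom
  have : IsNoetherian X.left := {}
  infer_instance

theorem PolarisedVariety.volume_pos {n : ℕ} (P : PolarisedVariety n) : 0 < P.volume := by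
  have := isLocallyNoetherian_of_isVariety P.X
  have := noetherianSpace_of_isVariety P.X
  exact Rat.cast_pos.2 (P.ample.intersection_pos P.proper (hasChain_genericPoint P.dim.ge))

end Positivity

/-! ### Integration in degrees zero and two, and reality of the intersection numbers. -/

section Integration

variable {X Y : CSch}

/-- A nonempty closed set has a closed point, and over `ℂ` a closed point is a complex point by the
Nullstellensatz. -/
theorem subvarietyPts_nonempty [LocallyOfFiniteType X.hom] (x : X.left) :
    (subvarietyPts x).Nonempty := by
  have : JacobsonSpace X.left := LocallyOfFiniteType.jacobsonSpace X.hom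
  obtain ⟨z, hz, hzc⟩ := nonempty_inter_closedPoints (Z := closure {x})
    ⟨x, subset_closure rfl⟩ isClosed_closure.isLocallyClosed
  have hz' : IsClosed {z} := hzc
  refine ⟨Over.homMk (pointOfClosedPoint X.hom z hz') (pointOfClosedPoint_comp X.hom z hz'), ?_⟩
  exact (specializes_iff_mem_closure.2 hz).trans
    (specializes_of_eq (pointOfClosedPoint_apply X.hom z hz' _).symm)

/-- The value at a point of a cohomology class of degree zero. -/
def evalCoh {S : Type} [TopologicalSpace S] (p : S) : Coh S 0 →ₗ[ℂ] ℂ :=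
  Submodule.liftQ _ ((LinearMap.proj (fun _ => p)).comp (cocycles S 0).subtype) (by
    intro z hz
    obtain ⟨U, -, hp, h⟩ := (show z.1 ∈ locallyZero S 0 from hz) p
    exact h _ fun _ => hp)

/-- For `d = 0` the defining property concerns the empty product only and says that 1 has integral
1. Evaluation at a point shows that such a functional exists, so `integral` is not its default value
0. -/
theorem integral_zero_one [LocallyOfFiniteType X.hom] (x : X.left) :
    integral x 0 (restrict x (2 * 0) (Coh.one (ComplexPts X))) = 1 := by
  obtain ⟨p, hp⟩ := subvarietyPts_nonempty x
  have hex : ∃ I, IsIntegration x 0 I := by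
    refine ⟨evalCoh ⟨p, hp⟩, fun M c z _ hz => ?_⟩
    refine (hz fun _ => p).trans ?_
    rw [Fin.prod_univ_zero, List.ofFn_zero]
    exact Rat.cast_one.symm
  rw [integral, dif_pos hex]
  refine (hex.choose_spec (fun i => i.elim0) (fun i => i.elim0) ⟨fun _ => 1, _⟩
    (fun i => i.elim0) fun v => ?_).trans ?_
  · rw [Fin.prod_univ_zero]
  · rw [List.ofFn_zero]
    exact Rat.cast_one

/-- Either the defining property with `d = 1` identifies the integral with a rational intersection
number, or `integral` is the zero default. -/
theorem integral_im_eq_zero {M : LineBundle X.left} {c : cocycles (ComplexPts X) 2}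
    (hc : IsChernCocycle M c) (x : X.left) :
    (integral x 1 (restrict x (2 * 1) (Coh.mk c))).im = 0 := by
  rw [integral]
  split_ifs with hex
  · have h := hex.choose_spec (fun _ => M) (fun _ => c) c (fun _ => hc) (fun v => by
      rw [Fin.prod_univ_one]
      exact congrArg c.1 (funext fun i => by fin_cases i <;> rfl))
    rw [h]
    exact Complex.ratCast_im _
  · rfl

/-- Parallel transport pulls back along `f`. Thus the pullback of a chosen Chern cocycle is a Chern
cocycle, with no need to compare different choices. -/
theorem IsChernCocycle.pullback {M : LineBundle Y.left} {c : cocycles (ComplexPts Y) 2}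
    (hc : IsChernCocycle M c) (f : X ⟶ Y) :
    IsChernCocycle (M.pullback f.left) (cocycles.pull (ComplexPts.mapC f) 2 c) := by
  obtain ⟨t, h1, h2, h3, h4⟩ := hc
  refine ⟨fun i j x y => t i j (x.map f) (y.map f), ?_, fun i x hx => h2 i _ hx, ?_,
    fun v i j k hi hj hk => h4 (fun a => (v a).map f) i j k hi hj hk⟩
  · intro i i' j j' x y hi hi' hj hj'
    have := h1 i i' j j' (x.map f) (y.map f) hi hi' hj hj'
    rw [ComplexPts.eval_map, ComplexPts.eval_map] at this
    exact this
  · intro i x hx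
    obtain ⟨N, hN, hxN, hNU, hcont⟩ := h3 i (x.map f) hx
    refine ⟨ComplexPts.map f ⁻¹' N, hN.preimage (ComplexPts.continuous_map f), hxN,
      fun y hy => hNU _ hy, ?_⟩
    exact hcont.comp (((ComplexPts.continuous_map f).prodMap
      (ComplexPts.continuous_map f)).continuousOn) fun q hq => ⟨hq.1, hq.2⟩

theorem integral_chernClass_im (M : LineBundle X.left) (x : X.left) :
    (integral x 1 (restrict x (2 * 1) (chernClass M))).im = 0 := by
  rw [chernClass]
  split_ifs with h
  · exact integral_im_eq_zero h.choose_spec x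
  · rw [map_zero, map_zero, Complex.zero_im]

theorem integral_pull_chernClass_im (f : X ⟶ Y) (M : LineBundle Y.left) (x : X.left) :
    (integral x 1 (restrict x (2 * 1)
      (Coh.pull (ComplexPts.mapC f) (2 * 1) (chernClass M)))).im = 0 := by
  rw [chernClass]
  split_ifs with h
  · exact integral_im_eq_zero (h.choose_spec.pullback f) x
  · rw [map_zero, map_zero, map_zero, Complex.zero_im]

theorem natCast_inv_mul_im (m : ℕ) {z : ℂ} (hz : z.im = 0) : ((m : ℂ)⁻¹ * z).im = 0 := by
  rw [← Complex.ofReal_natCast, ← Complex.ofReal_inv, Complex.im_ofReal_mul, hz, mul_zero]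

/-- Injectivity of `φ` makes it commute with `finsum` even when the support is infinite. -/
theorem cycleSum_map {S : Scheme.{0}} {A B : Type} [AddCommGroup A] [Module ℚ A] [AddCommGroup B]
    [Module ℚ B] (φ : A →+ B) (hφ : Function.Injective φ) (Ls : List (QLineBundle S)) (b : S → A)
    (x : S) : cycleSum Ls (fun y => φ (b y)) x = φ (cycleSum Ls b x) := by
  induction Ls generalizing x with
  | nil => rfl
  | cons L Ls ih =>
    simp only [cycleSum, ih]
    rw [φ.map_finsum_of_injective hφ]
    simp only [map_rat_smul]

theorem pairing_one (X : CSch) [IsVariety X] (Ls : List (QLineBundle X.left)) :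
    pairing X Ls (d := 0) (Coh.one (ComplexPts X)) = number X Ls := by
  rw [pairing, number, intersection, Complex.ofReal_ratCast]
  simp only [integral_zero_one]
  rw [← Rat.coe_castHom (α := ℂ)]
  exact (cycleSum_map (Rat.castHom ℂ).toAddMonoidHom (Rat.castHom ℂ).injective Ls
    (fun _ => 1) _).symm ▸ by simp

theorem pairing_im_eq_zero [IsVariety X] (Ls : List (QLineBundle X.left)) {d : ℕ}
    {θ : Coh (ComplexPts X) (2 * d)}
    (h : ∀ y, (integral y d (restrict y (2 * d) θ)).im = 0) : (pairing X Ls θ).im = 0 := by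
  have h1 : (fun y => integral y d (restrict y (2 * d) θ)) =
      fun y => Complex.ofRealHom.toAddMonoidHom (integral y d (restrict y (2 * d) θ)).re := by
    funext y
    exact Complex.ext rfl (h y)
  rw [pairing, h1, cycleSum_map _ Complex.ofReal_injective]
  exact Complex.ofReal_im _

variable {n : ℕ} {P : PolarisedVariety n}

theorem intX_one (l j : ℕ) : intX P l j (d := 0) (Coh.one _) =
    number P.X (List.replicate l P.L ++ List.replicate j P.K) :=
  pairing_one _ _

theorem intT_one {T : TestConfiguration P} (R : Resolution T) (l j : ℕ) :
    intT R l j (d := 0) (Coh.one _) =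
      number R.Y (List.replicate l (T.L.pullback R.r.left) ++
        List.replicate j (T.relK.pullback R.r.left)) :=
  pairing_one _ _

theorem intX_qChernClass (l j : ℕ) (H : QLineBundle P.X.left) :
    ((intX P l j (d := 1) (qChernClass H)).re : ℂ) = intX P l j (d := 1) (qChernClass H) := by
  refine Complex.ext rfl (pairing_im_eq_zero _ fun y => ?_).symm
  rw [qChernClass, map_smul, map_smul]
  exact natCast_inv_mul_im _ (integral_chernClass_im _ y)

theorem intT_qChernClass {T : TestConfiguration P} (R : Resolution T) (l j : ℕ)
    (H : QLineBundle P.X.left) :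
    ((intT R l j (d := 1) (qChernClass H)).re : ℂ) = intT R l j (d := 1) (qChernClass H) := by
  refine Complex.ext rfl (pairing_im_eq_zero _ fun y => ?_).symm
  rw [qChernClass, map_smul, map_smul, map_smul]
  exact natCast_inv_mul_im _ (integral_pull_chernClass_im _ _ y)

theorem cycleSum_zero {S : Scheme.{0}} {A : Type} [AddCommGroup A] [Module ℚ A]
    (Ls : List (QLineBundle S)) (x : S) : cycleSum Ls (fun _ => (0 : A)) x = 0 := by
  induction Ls generalizing x with
  | nil => rfl
  | cons L Ls ih => simp [cycleSum, ih]

theorem pairing_zero (X : CSch) [IsVariety X] (Ls : List (QLineBundle X.left)) {d : ℕ} :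
    pairing X Ls (0 : Coh (ComplexPts X) (2 * d)) = 0 := by
  simp [pairing, cycleSum_zero]

theorem intX_zero (l j : ℕ) {d : ℕ} : intX P l j (0 : Coh (ComplexPts P.X) (2 * d)) = 0 :=
  pairing_zero _ _

theorem intT_zero {T : TestConfiguration P} (R : Resolution T) (l j : ℕ) {d : ℕ} :
    intT R l j (0 : Coh (ComplexPts P.X) (2 * d)) = 0 := by
  rw [intT, map_zero]
  exact pairing_zero _ _

end Integration

/-! ### Quotients of polynomials at infinity. -/

section Asymptotics

open Polynomial in
-- Reversing the coefficients turns behaviour at infinity into behaviour at zero in the variable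
-- `k⁻¹`.
theorem sum_mul_pow_eq (c : ℕ → ℂ) (n : ℕ) {k : ℕ} (hk : k ≠ 0) :
    ∑ l ∈ Finset.range (n + 1), c l * (k : ℂ) ^ l =
      (k : ℂ) ^ n * (∑ l ∈ Finset.range (n + 1), C (c l) * X ^ (n - l)).eval ((k : ℂ)⁻¹) := by
  rw [eval_finsetSum, Finset.mul_sum]
  refine Finset.sum_congr rfl fun l hl => ?_
  obtain ⟨m, rfl⟩ := Nat.exists_eq_add_of_le (Nat.lt_succ_iff.1 (Finset.mem_range.1 hl))
  have hk' : (k : ℂ) ≠ 0 := Nat.cast_ne_zero.2 hk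
  simp only [eval_mul, eval_C, eval_pow, eval_X, Nat.add_sub_cancel_left, pow_add, inv_pow]
  field_simp

open Polynomial in
theorem coeff_sum_C_mul_X_pow (c : ℕ → ℂ) (n : ℕ) {i : ℕ} (hi : i ≤ n) :
    (∑ l ∈ Finset.range (n + 1), C (c l) * X ^ (n - l)).coeff i = c (n - i) := by
  rw [finsetSum_coeff, Finset.sum_eq_single (n - i)]
  · rw [coeff_C_mul_X_pow, if_pos (by omega)]
  · intro l hl hne
    rw [coeff_C_mul_X_pow, if_neg]
    have := Finset.mem_range.1 hl
    omega
  · intro h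
    exact absurd (Finset.mem_range.2 (by omega)) h

theorem tendsto_natCast_inv : Tendsto (fun k : ℕ => ((k : ℂ)⁻¹)) atTop (𝓝 0) :=
  tendsto_inv_atTop_nhds_zero_nat (𝕜 := ℂ)

open Polynomial in
/-- The expansion of a quotient of polynomials of the same degree at infinity. -/
theorem ratio_isBigO (c d : ℕ → ℂ) {n : ℕ} (hn : 1 ≤ n) (hc : c n ≠ 0) :
    (fun k : ℕ => (∑ l ∈ Finset.range (n + 1), d l * (k : ℂ) ^ l) /
        (∑ l ∈ Finset.range (n + 1), c l * (k : ℂ) ^ l) - d n / c n -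
      (d (n - 1) / c n - d n * c (n - 1) / c n ^ 2) * (k : ℂ)⁻¹) =O[atTop]
        fun k : ℕ => ((k : ℂ) ^ 2)⁻¹ := by
  set D : ℂ[X] := ∑ l ∈ Finset.range (n + 1), C (d l) * X ^ (n - l) with hD
  set E : ℂ[X] := ∑ l ∈ Finset.range (n + 1), C (c l) * X ^ (n - l) with hE
  set α := d n / c n
  set e := d (n - 1) / c n - d n * c (n - 1) / c n ^ 2
  have hD0 : D.coeff 0 = d n := coeff_sum_C_mul_X_pow d n (Nat.zero_le n)
  have hD1 : D.coeff 1 = d (n - 1) := coeff_sum_C_mul_X_pow d n hn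
  have hE0 : E.coeff 0 = c n := coeff_sum_C_mul_X_pow c n (Nat.zero_le n)
  have hE1 : E.coeff 1 = c (n - 1) := coeff_sum_C_mul_X_pow c n hn
  -- `α` and `e` are the first two Taylor coefficients of `D / E` at zero, so `D - (α + e X) E` has
  -- no terms of degree below two. The error is then `W / E` times `k⁻²`, bounded since `E` has
  -- constant term `c n ≠ 0`.
  obtain ⟨W, hW⟩ : X ^ 2 ∣ D - (C α * E + C e * (X * E)) := by
    rw [X_pow_dvd_iff]
    intro i hi
    interval_cases i
    · simp only [coeff_sub, coeff_add, coeff_C_mul, coeff_X_mul_zero, hD0, hE0, α]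
      field_simp
      ring
    · have : (X * E).coeff 1 = E.coeff 0 := coeff_X_mul E 0
      simp only [coeff_sub, coeff_add, coeff_C_mul, this, hD1, hE0, hE1, α, e]
      field_simp
      ring
  have hE0' : E.eval 0 ≠ 0 := by rwa [← coeff_zero_eq_eval_zero, hE0]
  have hlim : ∀ p : ℂ[X], Tendsto (fun k : ℕ => p.eval ((k : ℂ)⁻¹)) atTop (𝓝 (p.eval 0)) :=
    fun p => (p.continuous.tendsto 0).comp tendsto_natCast_inv
  have hbig : (fun k : ℕ => W.eval ((k : ℂ)⁻¹) / E.eval ((k : ℂ)⁻¹)) =O[atTop]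
      fun _ : ℕ => (1 : ℂ) := ((hlim W).div (hlim E) hE0').isBigO_one ℂ
  have hmul := hbig.mul (Asymptotics.isBigO_refl (fun k : ℕ => ((k : ℂ) ^ 2)⁻¹) atTop)
  simp only [one_mul] at hmul
  refine hmul.congr' ?_ EventuallyEq.rfl
  filter_upwards [eventually_ne_atTop 0, (hlim E).eventually_ne hE0'] with k hk hEk
  have hk' : (k : ℂ) ≠ 0 := Nat.cast_ne_zero.2 hk
  have hWk := congrArg (eval ((k : ℂ)⁻¹)) hW
  simp only [eval_sub, eval_add, eval_mul, eval_C, eval_X, eval_pow] at hWk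
  rw [sum_mul_pow_eq d n hk, sum_mul_pow_eq c n hk, ← hD, ← hE,
    mul_div_mul_left _ _ (pow_ne_zero n hk'),
    show eval ((k : ℂ)⁻¹) D = α * eval ((k : ℂ)⁻¹) E + e * ((k : ℂ)⁻¹ * eval ((k : ℂ)⁻¹) E) +
      (k : ℂ)⁻¹ ^ 2 * eval ((k : ℂ)⁻¹) W by linear_combination hWk]
  generalize eval ((k : ℂ)⁻¹) E = b at hEk ⊢
  field_simp
  ring

theorem im_ratio_isBigO (c d : ℕ → ℂ) {n : ℕ} (hn : 1 ≤ n) (hc : c n ≠ 0)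
    (h0 : (d n / c n).im = 0) :
    (fun k : ℕ => ((∑ l ∈ Finset.range (n + 1), d l * (k : ℂ) ^ l) /
        (∑ l ∈ Finset.range (n + 1), c l * (k : ℂ) ^ l)).im -
      (d (n - 1) / c n - d n * c (n - 1) / c n ^ 2).im * (k : ℝ)⁻¹) =O[atTop]
        fun k : ℕ => ((k : ℝ) ^ 2)⁻¹ := by
  have h := ratio_isBigO c d hn hc
  refine (Asymptotics.IsBigO.trans (Asymptotics.isBigO_of_le _ fun k => ?_) h).trans
    (Asymptotics.isBigO_of_le _ fun k => ?_)
  · refine le_trans (le_of_eq ?_) (Complex.abs_im_le_norm _)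
    rw [Real.norm_eq_abs, Complex.sub_im (_ - d n / c n), Complex.sub_im _ (d n / c n), h0,
      sub_zero, ← Complex.ofReal_natCast,
      ← Complex.ofReal_inv, Complex.im_mul_ofReal]
  · simp

/-- If `u(k) = e k⁻¹ + O(k⁻²)` is eventually nonnegative, then so is `e`. -/
theorem nonneg_of_isBigO {u : ℕ → ℝ} {e : ℝ}
    (h : (fun k : ℕ => u k - e * (k : ℝ)⁻¹) =O[atTop] fun k : ℕ => ((k : ℝ) ^ 2)⁻¹)
    (hu : ∀ᶠ k in atTop, 0 ≤ u k) : 0 ≤ e := by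
  have h1 := (Asymptotics.isBigO_refl (fun k : ℕ => (k : ℝ)) atTop).mul h
  have h2 : Tendsto (fun k : ℕ => (k : ℝ) * ((k : ℝ) ^ 2)⁻¹) atTop (𝓝 0) := by
    refine (tendsto_inv_atTop_nhds_zero_nat (𝕜 := ℝ)).congr' ?_
    filter_upwards [eventually_ne_atTop 0] with k hk
    have hk' : (k : ℝ) ≠ 0 := Nat.cast_ne_zero.2 hk
    field_simp
  have h3 := h1.trans_tendsto h2
  have h4 : Tendsto (fun k : ℕ => (k : ℝ) * u k) atTop (𝓝 e) := by
    have h5 := h3.add_const e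
    rw [zero_add] at h5
    refine h5.congr' ?_
    filter_upwards [eventually_ne_atTop 0] with k hk
    have hk' : (k : ℝ) ≠ 0 := Nat.cast_ne_zero.2 hk
    field_simp
    ring
  refine ge_of_tendsto h4 ?_
  filter_upwards [hu] with k hk
  exact mul_nonneg (Nat.cast_nonneg k) hk

end Asymptotics

/-! ### The expansion of the phase. -/

section Expansion

variable {n : ℕ} {P : PolarisedVariety n}

theorem expansion_coefficient {ρ : ℂ} {n V A κ B : ℝ} (hn : n ≠ 0) (hn' : n + 1 ≠ 0) (hV : V ≠ 0) :
    ((ρ / n * B) / (Complex.I * V) -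
      (Complex.I / (n + 1) * A) * (ρ * κ) / (Complex.I * V) ^ 2).im =
      -ρ.re * (n * (-κ / V) / (n + 1) * A + B) / (n * V) := by
  have hV' : (V : ℂ) ≠ 0 := Complex.ofReal_ne_zero.2 hV
  have hnc : (n : ℂ) ≠ 0 := Complex.ofReal_ne_zero.2 hn
  have hnc' : (n : ℂ) + 1 ≠ 0 := by exact_mod_cast hn'
  -- Since `1 / i = -i` and `i / i² = -i`, both terms are `-i ρ` times a real number, and `Im (-i ρ)
  -- = -Re ρ`.
  have key : (ρ / n * B) / (Complex.I * V) -
      (Complex.I / (n + 1) * A) * (ρ * κ) / (Complex.I * V) ^ 2 =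
      ((-Complex.I) * ρ) * (((n * (-κ / V) / (n + 1) * A + B) / (n * V) : ℝ) : ℂ) := by
    push_cast
    field_simp
    ring_nf
    simp only [Complex.I_sq]
    ring
  rw [key, Complex.im_mul_ofReal]
  simp only [neg_mul, Complex.neg_im, Complex.I_mul_im]
  ring

/-- The expansion of the phase of a test configuration, if the numbers which involve `Θ₁`
are real. -/
theorem CentralCharge.im_isBigO (hn : 1 ≤ n) (Z : CentralCharge P) {T : TestConfiguration P}
    (R : Resolution T) {θ θ' : ℝ} (hθ : (θ : ℂ) = intX P (n - 1) 0 (Z.Θ 1))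
    (hθ' : (θ' : ℂ) = intT R n 0 (Z.Θ 1)) :
    (fun k : ℕ => (Z.ZkT R k / Z.Zk k).im - -(Z.ρ (n - 1)).re *
      (n * (P.slope - θ / P.volume) / (n + 1) *
          number R.Y (List.replicate (n + 1) (T.L.pullback R.r.left)) +
        number R.Y (List.replicate n (T.L.pullback R.r.left) ++ [T.relK.pullback R.r.left]) +
          θ') / (n * P.volume) * (k : ℝ)⁻¹) =O[atTop] fun k : ℕ => ((k : ℝ) ^ 2)⁻¹ := by
  have hV : P.volume ≠ 0 := P.volume_pos.ne'
  have hVc : (P.volume : ℂ) ≠ 0 := Complex.ofReal_ne_zero.2 hV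
  set A := number R.Y (List.replicate (n + 1) (T.L.pullback R.r.left)) with hA
  set B := number R.Y (List.replicate n (T.L.pullback R.r.left) ++ [T.relK.pullback R.r.left])
    with hB
  set κ := number P.X (List.replicate (n - 1) P.L ++ [P.K]) with hκ
  set c : ℕ → ℂ := fun l => Z.ρ l *
    ∑ j ∈ Finset.range (n - l + 1), Z.a j * intX P l j (Z.Θ (n - l - j)) with hc
  set d : ℕ → ℂ := fun l => Z.ρ l / (l + 1) *
    ∑ j ∈ Finset.range (n - l + 1), Z.a j * intT R (l + 1) j (Z.Θ (n - l - j)) with hd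
  have hsub : n - (n - 1) = 1 := by omega
  have hcn : c n = Complex.I * P.volume := by
    simp only [hc, Nat.sub_self, zero_add, Finset.sum_range_one, Z.a_zero, one_mul, Z.ρ_top]
    congr 1
    -- The degree of the class is `n - n - 0`, which is only propositionally zero; generalizing over
    -- `i` avoids transport between dependent types.
    have h0 : ∀ i, i = 0 → intX P n 0 (Z.Θ i) = P.volume := by
      rintro _ rfl
      refine (congrArg _ Z.Θ_zero).trans ((intX_one n 0).trans ?_)
      rw [List.replicate_zero, List.append_nil]
      rfl
    exact h0 _ (by omega)
  have hdn : d n = Complex.I / (n + 1) * A := by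
    simp only [hd, Nat.sub_self, zero_add, Finset.sum_range_one, Z.a_zero, one_mul, Z.ρ_top]
    congr 1
    have h0 : ∀ i, i = 0 → intT R (n + 1) 0 (Z.Θ i) = A := by
      rintro _ rfl
      refine (congrArg _ Z.Θ_zero).trans ((intT_one R (n + 1) 0).trans ?_)
      rw [List.replicate_zero, List.append_nil]
    exact h0 _ (by omega)
  have hcn' : c (n - 1) = Z.ρ (n - 1) * ((κ + θ : ℝ) : ℂ) := by
    simp only [hc]
    rw [hsub, Finset.sum_range_succ, Finset.sum_range_one, Z.a_zero, Z.a_one, one_mul, one_mul,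
      add_comm]
    push_cast
    congr 2
    · exact (congrArg _ Z.Θ_zero).trans (intX_one (n - 1) 1)
    · exact hθ.symm
  have hdn' : d (n - 1) = Z.ρ (n - 1) / (n : ℝ) * ((B + θ' : ℝ) : ℂ) := by
    -- Writing `n = m + 1` turns the denominator `(n - 1) + 1` and the exponent of `ℒ` into `n`.
    obtain ⟨m, rfl⟩ := Nat.exists_eq_add_of_le' hn
    simp only [hd]
    rw [hsub, Finset.sum_range_succ, Finset.sum_range_one, Z.a_zero, Z.a_one, one_mul, one_mul,
      add_comm (intT _ _ _ _)]
    push_cast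
    congr 2
    · exact (congrArg _ Z.Θ_zero).trans (intT_one R (m + 1) 1)
    · exact hθ'.symm
  -- Both leading coefficients are `i` times a real number, so their quotient is real.
  have h := im_ratio_isBigO c d hn (by rw [hcn]; exact mul_ne_zero Complex.I_ne_zero hVc) (by
    rw [hcn, hdn]
    have : Complex.I / (n + 1) * A / (Complex.I * P.volume) =
        ((A / ((n + 1) * P.volume) : ℝ) : ℂ) := by
      have : ((n : ℂ) + 1) ≠ 0 := Nat.cast_add_one_ne_zero n
      have := Complex.I_ne_zero
      push_cast
      field_simp
    rw [this, Complex.ofReal_im])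
  have hcoef := expansion_coefficient (ρ := Z.ρ (n - 1)) (n := n) (A := A) (B := B + θ')
    (κ := κ + θ) (Nat.cast_ne_zero.2 (by omega)) (Nat.cast_add_one_ne_zero n) hV
  rw [hcn, hdn, hcn', hdn'] at h
  rw [Complex.ofReal_natCast] at hcoef h
  rw [hcoef] at h
  refine h.congr_left fun k => ?_
  congr 2
  · congr 2
    · funext l
      simp only [hd]
      ring
    · funext l
      simp only [hc]
      ring
  · rw [PolarisedVariety.slope, ← hκ, ← sub_div, neg_add', add_assoc]

theorem CentralCharge.AsymptoticallySemistable.nonneg (hn : 1 ≤ n) {Z : CentralCharge P}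
    (hZ : Z.AsymptoticallySemistable) (hρ : (Z.ρ (n - 1)).re < 0) {T : TestConfiguration P}
    (R : Resolution T) {e : ℝ}
    (h : (fun k : ℕ => (Z.ZkT R k / Z.Zk k).im -
      -(Z.ρ (n - 1)).re * e / (n * P.volume) * (k : ℝ)⁻¹) =O[atTop]
        fun k : ℕ => ((k : ℝ) ^ 2)⁻¹) : 0 ≤ e := by
  have h1 := nonneg_of_isBigO h (hZ T R)
  have hn' : (0 : ℝ) < n := Nat.cast_pos.2 hn
  have h2 := (le_div_iff₀ (mul_pos hn' P.volume_pos)).1 h1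
  rw [zero_mul] at h2
  exact (mul_nonneg_iff_of_pos_left (neg_pos.2 hρ)).1 h2

end Expansion

end ZStability

/-! ### The non-degenerate case and the map case. -/

theorem mainTheorem8 {n : ℕ} (hn : 1 ≤ n) (P : PolarisedVariety n) (Z : CentralCharge P) :
    (Z.IsNondegenerate →
      (Z.AsymptoticallySemistable → KSemistable P) ∧
      ∀ (T : TestConfiguration P) (R : Resolution T),
        (fun k : ℕ => (Z.ZkT R k / Z.Zk k).im -
          -(Z.ρ (n - 1)).re * DF R / (n * P.volume) * (k : ℝ)⁻¹) =O[atTop]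
            fun k : ℕ => ((k : ℝ) ^ 2)⁻¹) ∧
    ∀ (Y : CSch) [IsVariety Y], IsProper Y.hom →
      ∀ (p : P.X ⟶ Y) (H : QLineBundle Y.left), H.IsAmple → Z.IsMapType p H →
        (Z.AsymptoticallySemistable → KSemistableMap p H) ∧
        ∀ (T : TestConfiguration P) (R : Resolution T),
          (fun k : ℕ => (Z.ZkT R k / Z.Zk k).im -
            -(Z.ρ (n - 1)).re * DFMap p H R / (n * P.volume) * (k : ℝ)⁻¹) =O[atTop]
              fun k : ℕ => ((k : ℝ) ^ 2)⁻¹ := by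
  refine ⟨fun hZ => ?_, fun Y _ _ p H _ hZ => ?_⟩
  · have key : ∀ (T : TestConfiguration P) (R : Resolution T),
        (fun k : ℕ => (Z.ZkT R k / Z.Zk k).im -
          -(Z.ρ (n - 1)).re * DF R / (n * P.volume) * (k : ℝ)⁻¹) =O[atTop]
            fun k : ℕ => ((k : ℝ) ^ 2)⁻¹ := by
      intro T R
      -- Non-degeneracy makes both numbers involving `Θ₁` vanish.
      have h := Z.im_isBigO hn R (θ := 0) (θ' := 0) (by rw [hZ.2, intX_zero, Complex.ofReal_zero])
        (by rw [hZ.2, intT_zero, Complex.ofReal_zero])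
      rw [zero_div, sub_zero, add_zero] at h
      exact h
    exact ⟨fun hs T R => hs.nonneg hn hZ.1 R (key T R), key⟩
  · have key : ∀ (T : TestConfiguration P) (R : Resolution T),
        (fun k : ℕ => (Z.ZkT R k / Z.Zk k).im -
          -(Z.ρ (n - 1)).re * DFMap p H R / (n * P.volume) * (k : ℝ)⁻¹) =O[atTop]
            fun k : ℕ => ((k : ℝ) ^ 2)⁻¹ := by
      intro T R
      -- The two real numbers are the real parts of the intersection numbers with `c₁(p^*H)`,
      -- exactly those appearing in `slopeMap` and `DFMap`.
      exact Z.im_isBigO hn R (by rw [hZ.2.2]; exact intX_qChernClass _ _ _)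
        (by rw [hZ.2.2]; exact intT_qChernClass R _ _ _)
    exact ⟨fun hs T R => hs.nonneg hn hZ.1 R (key T R), key⟩
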